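/- **Theorem (the elliptic self-adjoint Grassmannian is Lagrangian).** *Boundary data.* Let $\Omega$ be a compact Riemannian manifold with smooth boundary $\partial\Omega$ and let $S\to\Omega$ be a Dirac bundle: a complex Hermitian vector bundle with a Clifford multiplication $T\Omega\otimes S\to S$, $u\cdot(v\cdot s)+v\cdot(u\cdot s)=-2\langle u,v\rangle s$, by which unit tangent vectors act unitarily, and with a Hermitian connection $\nabla$ such that $\nabla(V\cdot\xi)=(\nabla V)\cdot\xi+V\cdot\nabla\xi$, where $\nabla V$ is the Levi-Civita derivative. Its Dirac operator is $D\xi=\sum_j e_j\cdot\nabla_{e_j}\xi$. Let $\mathcal H=L^2(\partial S)$ be the Hilbert space of square integrable sections of $S|_{\partial\Omega}$ and let $J:\mathcal H\to\mathcal H$ be Clifford multiplication by the inward unit normal, so that $J^2=-1$ and $J$ is isometric. *Polarization.* Let $\mathcal H=\mathcal L_+\oplus\mathcal L_-$ be a polarization with $\mathcal L_+$ closed and $\mathcal L_-=\mathcal L_+^\perp=J(\mathcal L_+)$ (any such polarization is allowed), with orthogonal projections $\mathrm{pr}_\pm:\mathcal H\to\mathcal L_\pm$, and write $\phi_\pm=\mathrm{pr}_\pm\phi$.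 *Restricted Grassmannian.* $\mathrm{Gr}'$ is the set of closed subspaces $W\subset\mathcal H$ such that $\mathrm{pr}_+|_W:W\to\mathcal L_+$ is Fredholm and $\mathrm{pr}_-|_W:W\to\mathcal L_-$ is Hilbert–Schmidt. For $W\in\mathrm{Gr}'$ let $\mathcal J_2(W,W^\perp)$ be the Hilbert space of Hilbert–Schmidt operators $W\to W^\perp$. The maps $T\mapsto\mathrm{graph}(T)=\{x+Tx : x\in W\}$, $T\in\mathcal J_2(W,W^\perp)$, are taken as parametrizations of $\mathrm{Gr}'$ around $W$, so that $T_W\mathrm{Gr}'=\mathcal J_2(W,W^\perp)$. Put $$\Omega_W(A,B)=-\tfrac{i}{2}\,\mathrm{Tr}\,(A^\dagger B-B^\dagger A),\qquad A,B\in T_W\mathrm{Gr}'.$$ *Elliptic self-adjoint Grassmannian.* The adjoint of a subspace $W$ is $$W^\dagger=\{\psi\in\mathcal H:\ \langle\phi_+,\psi_-\rangle=\langle\phi_-,\psi_+\rangle\ \text{ for all }\phi\in W\},$$ where $\mathcal L_+$ and $\mathcal L_-$ are identified by $J$; equivalently, $W^\dagger$ is the annihilator of $W$ for $\omega(\phi,\psi)=\langle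 J\phi,\psi\rangle$. Let $\mathcal M$ be the set of self-adjoint subspaces, $W=W^\dagger$, and let $\mathcal M_{\mathrm{ellip}}=\mathcal M\cap\mathrm{Gr}'$ (the self-adjoint elliptic boundary conditions for $D$). *Claim.* The parametrizations above make $\mathrm{Gr}'$ a smooth Hausdorff manifold, $\Omega$ is a symplectic form on it (a smooth, closed, nondegenerate real $2$-form), and $\mathcal M_{\mathrm{ellip}}$ is a Lagrangian submanifold of $(\mathrm{Gr}',\Omega)$: it is an embedded smooth submanifold of $\mathrm{Gr}'$ and, for every $W\in\mathcal M_{\mathrm{ellip}}$, $$T_W\mathcal M_{\mathrm{ellip}}=\{A\in T_W\mathrm{Gr}' : \Omega_W(A,B)=0\ \text{ for all }B\in T_W\mathcal M_{\mathrm{ellip}}\}.$$ -/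

import Mathlib

open scoped ContDiff InnerProductSpace ENNReal Manifold Bundle

noncomputable section

/-! ### Hilbert–Schmidt operators -/

section HilbertSchmidt

variable (E F : Type*) [NormedAddCommGroup E] [InnerProductSpace ℂ E] [CompleteSpace E]
  [NormedAddCommGroup F] [InnerProductSpace ℂ F]

/-- Index set of a chosen orthonormal basis of a Hilbert space. -/
def OnbIndex : Type _ := ↥(exists_hilbertBasis ℂ E).choose

/-- A chosen orthonormal basis of a Hilbert space. -/
def onb : HilbertBasis (OnbIndex E) ℂ E := (exists_hilbertBasis ℂ E).choose_spec.choose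

/-- The trace `∑ᵢ ⟪eᵢ, T eᵢ⟫` of an operator (used for trace class operators only). -/
def opTrace (T : E →L[ℂ] E) : ℂ := ∑' i, ⟪onb E i, T (onb E i)⟫_ℂ

variable {E F} in
/-- `T` is Hilbert–Schmidt: `∑ᵢ ‖T eᵢ‖² < ∞` for an orthonormal basis `e` (the choice of the basis
does not matter). -/
def IsHilbertSchmidt (T : E →L[ℂ] F) : Prop := Summable fun i => ‖T (onb E i)‖ ^ 2

variable {E F} in
lemma isHilbertSchmidt_iff (T : E →L[ℂ] F) :
    IsHilbertSchmidt T ↔ Memℓp (fun i => T (onb E i)) 2 := by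
  rw [memℓp_gen_iff (by norm_num)]
  simp [IsHilbertSchmidt]

/-- The space `J₂(E, F)` of Hilbert–Schmidt operators, as a subspace of the bounded operators. -/
def hsSubmodule : Submodule ℂ (E →L[ℂ] F) where
  carrier := {T | IsHilbertSchmidt T}
  zero_mem' := by simp [IsHilbertSchmidt]
  add_mem' := by
    intro S T hS hT
    simp only [Set.mem_ofPred_eq, isHilbertSchmidt_iff] at *
    exact hS.add hT
  smul_mem' := by
    intro c T hT
    simp only [Set.mem_ofPred_eq, isHilbertSchmidt_iff] at *
    exact hT.const_smul c

/-- The space `J₂(E, F)` of Hilbert–Schmidt operators; it carries the Hilbert–Schmidt norm, not the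
operator norm. -/
def HS : Type _ := ↥(hsSubmodule E F)

instance : AddCommGroup (HS E F) := inferInstanceAs (AddCommGroup ↥(hsSubmodule E F))

instance : Module ℂ (HS E F) := inferInstanceAs (Module ℂ ↥(hsSubmodule E F))

variable {E F}

/-- The bounded operator underlying a Hilbert–Schmidt operator. -/
def HS.op : HS E F →ₗ[ℂ] E →L[ℂ] F := (hsSubmodule E F).subtype

lemma HS.op_injective : Function.Injective (HS.op : HS E F → E →L[ℂ] F) :=
  Subtype.val_injective

lemma HS.isHilbertSchmidt (T : HS E F) : IsHilbertSchmidt T.op := T.2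

/-- `T ↦ (T eᵢ)ᵢ`, which embeds `J₂(E, F)` into the space of square-summable families. -/
def HS.toLp : HS E F →ₗ[ℂ] lp (fun _ : OnbIndex E => F) 2 where
  toFun T := ⟨fun i => T.op (onb E i), (isHilbertSchmidt_iff _).1 T.isHilbertSchmidt⟩
  map_add' S T := by ext i; simp; rfl
  map_smul' c T := by ext i; simp

lemma HS.toLp_injective : Function.Injective (HS.toLp : HS E F → _) := by
  intro S T h
  apply HS.op_injective
  have h' : ∀ i, S.op (onb E i) = T.op (onb E i) := fun i =>
    congrArg (fun f : lp (fun _ : OnbIndex E => F) 2 => f i) h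
  have hd := (onb E).dense_span
  refine ContinuousLinearMap.ext_on (s := Set.range (onb E)) ?_ ?_
  · rw [dense_iff_closure_eq, ← Submodule.topologicalClosure_coe, hd]; rfl
  · rintro _ ⟨i, rfl⟩; exact h' i

instance : NormedAddCommGroup (HS E F) :=
  NormedAddCommGroup.induced (HS E F) _ HS.toLp HS.toLp_injective

/-- The inner product of `J₂(E, F)` is `⟪S, T⟫ = ∑ᵢ ⟪S eᵢ, T eᵢ⟫ = Tr (S† T)`. -/
instance : InnerProductSpace ℂ (HS E F) where
  norm_smul_le c T := by
    change ‖HS.toLp (c • T)‖ ≤ ‖c‖ * ‖HS.toLp T‖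
    rw [map_smul, norm_smul]
  inner S T := ⟪HS.toLp S, HS.toLp T⟫_ℂ
  norm_sq_eq_re_inner T := norm_sq_eq_re_inner (𝕜 := ℂ) (HS.toLp T)
  conj_inner_symm S T := inner_conj_symm (HS.toLp S) (HS.toLp T)
  add_left R S T := by
    change ⟪HS.toLp (R + S), HS.toLp T⟫_ℂ = ⟪HS.toLp R, HS.toLp T⟫_ℂ + ⟪HS.toLp S, HS.toLp T⟫_ℂ
    rw [map_add, inner_add_left]
  smul_left S T c := by
    change ⟪HS.toLp (c • S), HS.toLp T⟫_ℂ = _ * ⟪HS.toLp S, HS.toLp T⟫_ℂ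
    rw [map_smul, inner_smul_left]

end HilbertSchmidt

/-! ### Manifolds modelled on several normed spaces

A smooth structure on a set `N` of points is given by a family of injective parametrizations
`φ p : E p → N`, one for every point `p`, with `φ p 0 = p`; the normed spaces `E p` may vary with
the point. The space `E p` is the tangent space at `p`. -/

section Manifold

variable {X : Type*} {E : X → Type*} [∀ p, NormedAddCommGroup (E p)] [∀ p, NormedSpace ℝ (E p)]
  (φ : ∀ p, E p → X)

/-- The change of coordinates from the parametrization at `p` to the one at `q`; it is meaningful
on `φ p ⁻¹' Set.range (φ q)`. -/
def transition (p q : X) : E p → E q := Function.invFun (φ q) ∘ φ p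

/-- The parametrizations `φ p`, `p ∈ N`, make `N` a (Hausdorff) smooth manifold. -/
structure IsSmoothManifold (N : Set X) : Prop where
  centred : ∀ p ∈ N, φ p 0 = p
  injective : ∀ p ∈ N, Function.Injective (φ p)
  range_subset : ∀ p ∈ N, Set.range (φ p) ⊆ N
  isOpen_overlap : ∀ p ∈ N, ∀ q ∈ N, IsOpen (φ p ⁻¹' Set.range (φ q))
  smooth_transition : ∀ p ∈ N, ∀ q ∈ N,
    ContDiffOn ℝ ∞ (transition φ p q) (φ p ⁻¹' Set.range (φ q))
  hausdorff : ∀ p ∈ N, ∀ q ∈ N, p ≠ q → ∃ (U : Set (E p)) (V : Set (E q)),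
    IsOpen U ∧ IsOpen V ∧ 0 ∈ U ∧ 0 ∈ V ∧ Disjoint (φ p '' U) (φ q '' V)

/-- `M` is an embedded smooth submanifold: around each of its points there is a smooth change of
coordinates which takes `M` to a closed subspace that has a closed complement. -/
def IsSubmanifold (M : Set X) : Prop :=
  ∀ p ∈ M, ∃ (e : OpenPartialHomeomorph (E p) (E p)) (S : Submodule ℝ (E p)),
    0 ∈ e.source ∧ ContDiffOn ℝ ∞ e e.source ∧ ContDiffOn ℝ ∞ e.symm e.target ∧
    S.ClosedComplemented ∧ ∀ x ∈ e.source, φ p x ∈ M ↔ e x ∈ S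

/-- The tangent vectors at `p` of `M`: the velocities at `p` of the smooth curves in `M`. -/
def tangentSet (M : Set X) (p : X) : Set (E p) :=
  {v | ∃ c : ℝ → E p, c 0 = 0 ∧ ContDiffAt ℝ ∞ c 0 ∧ (∀ᶠ t in nhds 0, φ p (c t) ∈ M) ∧
    HasDerivAt c v 0}

variable (Ω : ∀ p, E p → E p → ℂ)

/-- The expression at `x` of the form `Ω` in the coordinates `φ p`: the value of `Ω` at the point
`q = φ p x` on the images in `E q` of two vectors `A`, `B` of `E p`. -/
def localForm (p : X) (x A B : E p) : ℂ :=
  Ω (φ p x) (fderiv ℝ (transition φ p (φ p x)) x A) (fderiv ℝ (transition φ p (φ p x)) x B)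

/-- `Ω` is a symplectic form on `N`: a smooth, closed, nondegenerate real `2`-form. -/
structure IsSymplecticForm (N : Set X) : Prop where
  real : ∀ p ∈ N, ∀ A B, (Ω p A B).im = 0
  add_left : ∀ p ∈ N, ∀ A A' B, Ω p (A + A') B = Ω p A B + Ω p A' B
  smul_left : ∀ p ∈ N, ∀ (c : ℝ) (A B), Ω p (c • A) B = c * Ω p A B
  antisymm : ∀ p ∈ N, ∀ A B, Ω p B A = -Ω p A B
  nondegenerate : ∀ p ∈ N, ∀ A, (∀ B, Ω p A B = 0) → A = 0
  smooth : ∀ p ∈ N, ContDiff ℝ ∞ fun z : E p × E p × E p => localForm φ Ω p z.1 z.2.1 z.2.2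
  closed : ∀ p ∈ N, ∀ x A B C : E p,
    fderiv ℝ (fun y => localForm φ Ω p y B C) x A + fderiv ℝ (fun y => localForm φ Ω p y C A) x B
      + fderiv ℝ (fun y => localForm φ Ω p y A B) x C = 0

/-- `M` is a Lagrangian submanifold of the symplectic manifold `(N, Ω)`: a submanifold each of whose
tangent spaces equals its own `Ω`-orthogonal. -/
structure IsLagrangianSubmanifold (N M : Set X) : Prop where
  manifold : IsSmoothManifold φ N
  symplectic : IsSymplecticForm φ Ω N
  subset : M ⊆ N
  submanifold : IsSubmanifold φ M
  lagrangian : ∀ p ∈ M, tangentSet φ M p = {A | ∀ B ∈ tangentSet φ M p, Ω p A B = 0}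

end Manifold

/-! ### Grassmannians of a polarized symplectic-Hermitian space -/

section Grassmannian

variable {H : Type*} [NormedAddCommGroup H] [InnerProductSpace ℂ H]

variable (H) in
/-- A compatible complex structure on a complex Hilbert space: a complex linear isometry `J` with
`J² = -1`. The associated skew-Hermitian form is `ω(φ, ψ) = ⟪J φ, ψ⟫`. -/
structure CompatibleStructure where
  J : H →L[ℂ] H
  sq : ∀ ξ, J (J ξ) = -ξ
  isometry : ∀ ξ ζ, ⟪J ξ, J ζ⟫_ℂ = ⟪ξ, ζ⟫_ℂ

/-- A polarization `H = L₊ ⊕ L₋` into orthogonal closed subspaces that are exchanged (and thereby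
identified) by `J`. -/
structure Polarization (𝒥 : CompatibleStructure H) where
  plus : ClosedSubmodule ℂ H
  map_plus : plus.toSubmodule.map (𝒥.J : H →ₗ[ℂ] H) = plus.toSubmoduleᗮ

variable [CompleteSpace H]

instance (W : ClosedSubmodule ℂ H) : CompleteSpace W.toSubmodule :=
  W.isClosed.completeSpace_coe

/-- The graph `{x + T x | x ∈ W}` of a bounded operator `T : W → Wᗮ`. -/
def graphSubspace (W : ClosedSubmodule ℂ H) (T : W.toSubmodule →L[ℂ] W.toSubmoduleᗮ) :
    ClosedSubmodule ℂ H where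
  toSubmodule := (W.toSubmodule.subtypeL + W.toSubmoduleᗮ.subtypeL ∘L T).range
  isClosed' := by
    have h : AntilipschitzWith 1 (W.toSubmodule.subtypeL + W.toSubmoduleᗮ.subtypeL ∘L T) := by
      refine AddMonoidHomClass.antilipschitz_of_bound _ fun x => ?_
      have h0 : ⟪(x : H), (T x : H)⟫_ℂ = 0 :=
        Submodule.inner_right_of_mem_orthogonal x.2 (T x).2
      have h1 := norm_add_sq_eq_norm_sq_add_norm_sq_of_inner_eq_zero (x : H) (T x : H) h0
      have h2 : ‖(x : H)‖ ≤ ‖(x : H) + (T x : H)‖ := by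
        nlinarith [norm_nonneg (x : H), norm_nonneg ((x : H) + (T x : H)), norm_nonneg (T x : H)]
      simpa using h2
    exact h.isClosed_range (ContinuousLinearMap.uniformContinuous _)

/-- The tangent space `J₂(W, Wᗮ)` at `W` of the Grassmannian. -/
abbrev GrTangent (W : ClosedSubmodule ℂ H) : Type _ := HS W.toSubmodule W.toSubmoduleᗮ

/-- The standard parametrization of the Grassmannian around `W`: the Hilbert–Schmidt operator
`T : W → Wᗮ` gives the graph of `T`. -/
def grChart (W : ClosedSubmodule ℂ H) (T : GrTangent W) : ClosedSubmodule ℂ H :=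
  graphSubspace W T.op

/-- `Ω_W(A, B) = -(i/2) Tr (A†B - B†A)` for `A`, `B` in `J₂(W, Wᗮ)`. -/
def grForm (W : ClosedSubmodule ℂ H) (A B : GrTangent W) : ℂ :=
  -(Complex.I / 2) * opTrace W.toSubmodule (A.op.adjoint ∘L B.op - B.op.adjoint ∘L A.op)

namespace Polarization

variable {𝒥 : CompatibleStructure H} (P : Polarization 𝒥)

/-- The orthogonal projection onto `L₊`. -/
def prPlus : H →L[ℂ] P.plus.toSubmodule := P.plus.toSubmodule.orthogonalProjectionOnto

/-- The orthogonal projection onto `L₋`. -/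
def prMinus : H →L[ℂ] P.plus.toSubmoduleᗮ := P.plus.toSubmoduleᗮ.orthogonalProjectionOnto

/-- The restricted Grassmannian: the closed subspaces `W` for which `pr₊ : W → L₊` is Fredholm and
`pr₋ : W → L₋` is Hilbert–Schmidt. -/
def restrictedGrassmannian : Set (ClosedSubmodule ℂ H) :=
  {W | (P.prPlus ∘L W.toSubmodule.subtypeL).IsFredholm ∧
    IsHilbertSchmidt (P.prMinus ∘L W.toSubmodule.subtypeL)}

/-- The adjoint `W†` of a subspace `W`: the vectors `ψ` with `⟪φ₊, ψ₋⟫ = ⟪φ₋, ψ₊⟫` for all `φ` in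
`W`, where `L₊` and `L₋` are identified by `J`. -/
def adjointSet (W : ClosedSubmodule ℂ H) : Set H :=
  {ψ | ∀ φ ∈ W, ⟪𝒥.J (P.prPlus φ), (P.prMinus ψ : H)⟫_ℂ = ⟪(P.prMinus φ : H), 𝒥.J (P.prPlus ψ)⟫_ℂ}

/-- The self-adjoint subspaces, `W = W†`. -/
def selfAdjointSubspaces : Set (ClosedSubmodule ℂ H) := {W | (W : Set H) = P.adjointSet W}

/-- `W†` is the annihilator of `W` for the form `ω(φ, ψ) = ⟪J φ, ψ⟫`. -/
lemma mem_adjointSet_iff (W : ClosedSubmodule ℂ H) (ψ : H) :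
    ψ ∈ P.adjointSet W ↔ ∀ φ ∈ W, ⟪𝒥.J φ, ψ⟫_ℂ = 0 := by
  have hskew : ∀ a b, ⟪𝒥.J a, b⟫_ℂ = -⟪a, 𝒥.J b⟫_ℂ := by
    intro a b
    rw [← 𝒥.isometry (𝒥.J a) b, 𝒥.sq, inner_neg_left]
  have hJ : ∀ x ∈ P.plus.toSubmodule, 𝒥.J x ∈ P.plus.toSubmoduleᗮ := by
    intro x hx
    rw [← P.map_plus]
    exact Submodule.mem_map_of_mem hx
  have hdec : ∀ x : H, x = P.prPlus x + P.prMinus x := fun x =>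
    (P.plus.toSubmodule.starProjection_add_starProjection_orthogonal x).symm
  refine forall₂_congr fun φ _ => ?_
  have key : ⟪𝒥.J φ, ψ⟫_ℂ =
      ⟪𝒥.J (P.prPlus φ), (P.prMinus ψ : H)⟫_ℂ - ⟪(P.prMinus φ : H), 𝒥.J (P.prPlus ψ)⟫_ℂ := by
    have h1 : ⟪𝒥.J (P.prPlus φ), (P.prPlus ψ : H)⟫_ℂ = 0 :=
      Submodule.inner_left_of_mem_orthogonal (P.prPlus ψ).2 (hJ _ (P.prPlus φ).2)
    have h2 : ⟪𝒥.J (P.prMinus φ), (P.prMinus ψ : H)⟫_ℂ = 0 := by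
      obtain ⟨y, hy, hy'⟩ := P.map_plus.ge (P.prMinus φ).2
      have : 𝒥.J (P.prMinus φ) = -y := by rw [← 𝒥.sq y]; exact congrArg 𝒥.J hy'.symm
      rw [this, inner_neg_left, Submodule.inner_right_of_mem_orthogonal hy (P.prMinus ψ).2,
        neg_zero]
    conv_lhs => rw [hdec φ, hdec ψ]
    rw [map_add, inner_add_left, inner_add_right, inner_add_right, h1, h2,
      hskew (P.prMinus φ : H) (P.prPlus ψ : H)]
    ring
  rw [key, sub_eq_zero]

/-- The elliptic self-adjoint Grassmannian. -/
def ellipticSelfAdjoint : Set (ClosedSubmodule ℂ H) :=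
  P.selfAdjointSubspaces ∩ P.restrictedGrassmannian

end Polarization

end Grassmannian

/-! ### Dirac bundles and the Hilbert space of boundary data -/

section Dirac

variable {n : ℕ} [NeZero n] {M : Type*} [EMetricSpace M] [ChartedSpace (EuclideanHalfSpace n) M]

/-- Smooth vector fields on a manifold with boundary. -/
def IsSmoothField [IsManifold (𝓡∂ n) ∞ M] (V : ∀ x : M, TangentSpace (𝓡∂ n) x) : Prop :=
  ContMDiff (𝓡∂ n) (𝓡∂ n).tangent ∞ fun x => (⟨x, V x⟩ : TangentBundle (𝓡∂ n) M)

variable (n) in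
/-- Smooth sections of a complex vector bundle with fibre `F`. -/
def IsSmoothSection (F : Type*) [NormedAddCommGroup F] [NormedSpace ℂ F] {S : M → Type*}
    [TopologicalSpace (Bundle.TotalSpace F S)] [∀ x, NormedAddCommGroup (S x)]
    [∀ x, InnerProductSpace ℂ (S x)] [FiberBundle F S] (ξ : ∀ x, S x) : Prop :=
  ContMDiff (𝓡∂ n) ((𝓡∂ n).prod 𝓘(ℝ, F)) ∞ fun x => (⟨x, ξ x⟩ : Bundle.TotalSpace F S)

variable (n M) in
/-- The volume of the boundary for the induced Riemannian metric, as a measure on the manifold: the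
`(n-1)`-dimensional Hausdorff measure of the Riemannian distance, restricted to the boundary. The
factor is the volume of a Euclidean ball of diameter one, since Mathlib's Hausdorff measure is not
normalized. -/
def boundaryVolume [MeasurableSpace M] [BorelSpace M] : MeasureTheory.Measure M :=
  MeasureTheory.volume (Metric.ball (0 : EuclideanSpace ℝ (Fin (n - 1))) (1 / 2)) •
    (MeasureTheory.Measure.hausdorffMeasure ((n : ℝ) - 1)).restrict ((𝓡∂ n).boundary M)

lemma ae_mem_boundary [IsManifold (𝓡∂ n) ∞ M] [MeasurableSpace M] [BorelSpace M] :
    ∀ᵐ x ∂(boundaryVolume n M), x ∈ (𝓡∂ n).boundary M := by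
  have h : IsClosed ((𝓡∂ n).boundary M) :=
    ModelWithCorners.isClosed_boundary (n := ∞) (I := 𝓡∂ n) (M := M) (by simp)
  exact MeasureTheory.Measure.ae_smul_measure (MeasureTheory.ae_restrict_mem h.measurableSet) _

variable [IsManifold (𝓡∂ n) ∞ M] [Bundle.RiemannianBundle fun x : M => TangentSpace (𝓡∂ n) x]

variable (n M) in
/-- The inward unit normal of the boundary, extended in any way to a smooth vector field. In the
preferred chart at a boundary point, a tangent vector is tangent to the boundary if its coordinate
`0` vanishes, and it points inward if this coordinate is positive. -/
structure InwardNormal where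
  field : ∀ x : M, TangentSpace (𝓡∂ n) x
  smooth : IsSmoothField field
  unit : ∀ x ∈ (𝓡∂ n).boundary M, ‖field x‖ = 1
  orthogonal : ∀ x ∈ (𝓡∂ n).boundary M, ∀ v : TangentSpace (𝓡∂ n) x,
    (show EuclideanSpace ℝ (Fin n) from v) 0 = 0 → ⟪field x, v⟫_ℝ = 0
  inward : ∀ x ∈ (𝓡∂ n).boundary M, 0 < (show EuclideanSpace ℝ (Fin n) from field x) 0

variable (n) (F : Type*) [NormedAddCommGroup F] [NormedSpace ℂ F]
  (S : M → Type*) [TopologicalSpace (Bundle.TotalSpace F S)]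
  [∀ x, NormedAddCommGroup (S x)] [∀ x, InnerProductSpace ℂ (S x)] [FiberBundle F S] [VectorBundle ℂ F S] [VectorBundle ℝ F S]
  [ContMDiffVectorBundle ∞ F S (𝓡∂ n)]

/-- A Dirac bundle over a Riemannian manifold with boundary: a complex vector bundle `S` with a
smooth Hermitian metric, a Clifford multiplication that is unitary for unit vectors, and a Hermitian
connection `nabla` for which Clifford multiplication is parallel. -/
structure DiracBundle where
  hermitian_smooth : ∀ ξ ζ : ∀ x, S x, IsSmoothSection n F ξ → IsSmoothSection n F ζ →
    ContMDiff (𝓡∂ n) 𝓘(ℝ, ℂ) ∞ fun x => ⟪ξ x, ζ x⟫_ℂ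
  clifford : ∀ x : M, TangentSpace (𝓡∂ n) x →ₗ[ℝ] S x →ₗ[ℂ] S x
  clifford_smooth : ∀ V (ξ : ∀ x, S x), IsSmoothField V → IsSmoothSection n F ξ →
    IsSmoothSection n F fun x => clifford x (V x) (ξ x)
  clifford_relation : ∀ (x : M) (u v : TangentSpace (𝓡∂ n) x) (s : S x),
    clifford x u (clifford x v s) + clifford x v (clifford x u s) = (-2 * ⟪u, v⟫_ℝ) • s
  clifford_unitary : ∀ (x : M) (u : TangentSpace (𝓡∂ n) x), ‖u‖ = 1 →
    ∀ s t : S x, ⟪clifford x u s, clifford x u t⟫_ℂ = ⟪s, t⟫_ℂ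
  leviCivita : CovariantDerivative (𝓡∂ n) (EuclideanSpace ℝ (Fin n))
    fun x : M => TangentSpace (𝓡∂ n) x
  leviCivita_torsion : ∀ (V W : ∀ x : M, TangentSpace (𝓡∂ n) x), IsSmoothField V →
    IsSmoothField W → ∀ x, leviCivita W x (V x) - leviCivita V x (W x) =
      VectorField.mlieBracket (𝓡∂ n) V W x
  leviCivita_metric : ∀ (V W : ∀ x : M, TangentSpace (𝓡∂ n) x), IsSmoothField V →
    IsSmoothField W → ∀ x v, mfderiv (𝓡∂ n) 𝓘(ℝ, ℝ) (fun y => ⟪V y, W y⟫_ℝ) x v =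
      ⟪leviCivita V x v, W x⟫_ℝ + ⟪V x, leviCivita W x v⟫_ℝ
  nabla : CovariantDerivative (𝓡∂ n) F S
  nabla_smooth : ∀ V (ξ : ∀ x, S x), IsSmoothField V → IsSmoothSection n F ξ →
    IsSmoothSection n F fun x => nabla ξ x (V x)
  nabla_complex : ∀ ξ : ∀ x, S x, IsSmoothSection n F ξ →
    ∀ x v, nabla (fun y => Complex.I • ξ y) x v = Complex.I • nabla ξ x v
  nabla_hermitian : ∀ ξ ζ : ∀ x, S x, IsSmoothSection n F ξ → IsSmoothSection n F ζ →
    ∀ x v, mfderiv (𝓡∂ n) 𝓘(ℝ, ℂ) (fun y => ⟪ξ y, ζ y⟫_ℂ) x v =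
      ⟪nabla ξ x v, ζ x⟫_ℂ + ⟪ξ x, nabla ζ x v⟫_ℂ
  nabla_clifford : ∀ V (ξ : ∀ x, S x), IsSmoothField V → IsSmoothSection n F ξ →
    ∀ x v, nabla (fun y => clifford y (V y) (ξ y)) x v =
      clifford x (leviCivita V x v) (ξ x) + clifford x (V x) (nabla ξ x v)

namespace DiracBundle

variable {n F S} [MeasurableSpace M] [BorelSpace M] (𝒟 : DiracBundle n F S)

/-- The Dirac operator `D ξ = ∑ⱼ eⱼ · ∇_{eⱼ} ξ`, for an orthonormal basis `e` of the tangent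
space. -/
def diracOperator (ξ : ∀ x, S x) (x : M) : S x :=
  haveI : FiniteDimensional ℝ (TangentSpace (𝓡∂ n) x) :=
    inferInstanceAs (FiniteDimensional ℝ (EuclideanSpace ℝ (Fin n)))
  ∑ j, 𝒟.clifford x (stdOrthonormalBasis ℝ (TangentSpace (𝓡∂ n) x) j)
    (𝒟.nabla ξ x (stdOrthonormalBasis ℝ (TangentSpace (𝓡∂ n) x) j))

lemma smul_smooth (c : ℂ) {ξ : ∀ x, S x} (hξ : IsSmoothSection n F ξ) :
    IsSmoothSection n F fun x => c • ξ x := by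
  intro x₀
  have h := (Bundle.contMDiffAt_section x₀).1 (hξ x₀)
  refine (Bundle.contMDiffAt_section x₀).2 ?_
  have h' : ContMDiffAt (𝓡∂ n) 𝓘(ℝ, F) ∞
      (fun x => c • (trivializationAt F S x₀ ⟨x, ξ x⟩).2) x₀ :=
    (contDiff_const_smul c).contMDiff.contMDiffAt.comp x₀ h
  refine h'.congr_of_eventuallyEq ?_
  have hn := (trivializationAt F S x₀).open_baseSet.mem_nhds
    (FiberBundle.mem_baseSet_trivializationAt F S x₀)
  filter_upwards [hn] with x hx
  exact ((trivializationAt F S x₀).linear ℂ hx).map_smul c (ξ x)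

lemma integrable_inner (𝒟 : DiracBundle n F S) {ξ ζ : ∀ x, S x} (hξ : IsSmoothSection n F ξ) (hζ : IsSmoothSection n F ζ)
    (hξ' : MeasureTheory.Integrable (fun x => ‖ξ x‖ ^ 2) (boundaryVolume n M))
    (hζ' : MeasureTheory.Integrable (fun x => ‖ζ x‖ ^ 2) (boundaryVolume n M)) :
    MeasureTheory.Integrable (fun x => ⟪ξ x, ζ x⟫_ℂ) (boundaryVolume n M) := by
  refine (hξ'.add hζ').mono (𝒟.hermitian_smooth ξ ζ hξ hζ).continuous.aestronglyMeasurable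
    (Filter.Eventually.of_forall fun x => ?_)
  have h := norm_inner_le_norm (𝕜 := ℂ) (ξ x) (ζ x)
  simp only [Pi.add_apply]
  rw [Real.norm_of_nonneg (by positivity)]
  nlinarith [sq_nonneg (‖ξ x‖ - ‖ζ x‖), sq_nonneg ‖ξ x‖, sq_nonneg ‖ζ x‖]

/-- The smooth sections of `S` that are square integrable over the boundary; on a compact manifold,
all smooth sections. -/
def smoothSections : Submodule ℂ (∀ x, S x) where
  carrier := {ξ | IsSmoothSection n F ξ ∧
    MeasureTheory.Integrable (fun x => ‖ξ x‖ ^ 2) (boundaryVolume n M)}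
  zero_mem' := by
    refine ⟨?_, by simp⟩
    exact Bundle.contMDiff_zeroSection ℝ S
  add_mem' := by
    rintro ξ ζ ⟨hξ, hξ'⟩ ⟨hζ, hζ'⟩
    have hs : IsSmoothSection n F (ξ + ζ) := ContMDiff.add_section hξ hζ
    refine ⟨hs, ?_⟩
    have hc : Continuous fun x => ‖(ξ + ζ) x‖ ^ 2 := by
      have := (𝒟.hermitian_smooth _ _ hs hs).continuous
      simp only [inner_self_eq_norm_sq_to_K] at this
      have h2 := Complex.continuous_re.comp this
      refine h2.congr fun x => ?_
      simp only [Function.comp]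
      norm_cast
    refine ((hξ'.add hζ').const_mul 2).mono hc.aestronglyMeasurable
      (Filter.Eventually.of_forall fun x => ?_)
    simp only [Pi.add_apply]
    rw [Real.norm_of_nonneg (by positivity), Real.norm_of_nonneg (by positivity)]
    have := norm_add_le (ξ x) (ζ x)
    nlinarith [sq_nonneg (‖ξ x‖ - ‖ζ x‖), norm_nonneg (ξ x + ζ x), norm_nonneg (ξ x),
      norm_nonneg (ζ x)]
  smul_mem' := by
    rintro c ξ ⟨hξ, hξ'⟩
    refine ⟨smul_smooth c hξ, ?_⟩
    simp only [Pi.smul_apply, norm_smul, mul_pow]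
    exact hξ'.const_mul _

/-- The smooth sections with the (semidefinite) inner product
`⟪ξ, ζ⟫ = ∫_∂M ⟪ξ x, ζ x⟫` of their boundary values. -/
def PreBoundarySpace : Type _ := ↥𝒟.smoothSections

instance : AddCommGroup 𝒟.PreBoundarySpace := inferInstanceAs (AddCommGroup ↥𝒟.smoothSections)

instance : Module ℂ 𝒟.PreBoundarySpace := inferInstanceAs (Module ℂ ↥𝒟.smoothSections)

variable {𝒟} in
/-- The section underlying an element of `PreBoundarySpace`. -/
def PreBoundarySpace.toSection : 𝒟.PreBoundarySpace →ₗ[ℂ] ∀ x, S x := 𝒟.smoothSections.subtype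

/-- The inner product of the boundary values. -/
@[reducible]
def boundaryCore : PreInnerProductSpace.Core ℂ 𝒟.PreBoundarySpace where
  inner ξ ζ := ∫ x, ⟪ξ.toSection x, ζ.toSection x⟫_ℂ ∂(boundaryVolume n M)
  conj_inner_symm ξ ζ := by
    rw [← integral_conj]
    simp only [inner_conj_symm]
  re_inner_nonneg ξ := by
    have h : ∀ x, ⟪ξ.toSection x, ξ.toSection x⟫_ℂ = ((‖ξ.toSection x‖ ^ 2 : ℝ) : ℂ) := fun x => by
      rw [inner_self_eq_norm_sq_to_K]; norm_cast
    simp only [h]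
    rw [integral_complex_ofReal]
    exact MeasureTheory.integral_nonneg fun x => by positivity
  add_left ξ ζ η := by
    refine Eq.trans ?_ (MeasureTheory.integral_add (𝒟.integrable_inner ξ.2.1 η.2.1 ξ.2.2 η.2.2)
      (𝒟.integrable_inner ζ.2.1 η.2.1 ζ.2.2 η.2.2))
    exact MeasureTheory.integral_congr_ae (Filter.Eventually.of_forall fun x =>
      inner_add_left (ξ.toSection x) (ζ.toSection x) (η.toSection x))
  smul_left ξ ζ c := by
    rw [← MeasureTheory.integral_const_mul]
    exact MeasureTheory.integral_congr_ae
      (Filter.Eventually.of_forall fun x => inner_smul_left (ξ.toSection x) (ζ.toSection x) c)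

instance : SeminormedAddCommGroup 𝒟.PreBoundarySpace :=
  @InnerProductSpace.Core.toSeminormedAddCommGroup ℂ 𝒟.PreBoundarySpace _ _ _ 𝒟.boundaryCore

instance : InnerProductSpace ℂ 𝒟.PreBoundarySpace := InnerProductSpace.ofCore 𝒟.boundaryCore

/-- The Hilbert space `L²(∂S)` of boundary data: the (Hausdorff) completion of the space of boundary
values of smooth sections. -/
abbrev BoundarySpace : Type _ := UniformSpace.Completion 𝒟.PreBoundarySpace

variable (ν : InwardNormal n M)

/-- Clifford multiplication by the inward unit normal, on smooth sections. -/
def normalMul : 𝒟.PreBoundarySpace →ₗ[ℂ] 𝒟.PreBoundarySpace where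
  toFun ξ := ⟨fun x => 𝒟.clifford x (ν.field x) (ξ.toSection x),
    𝒟.clifford_smooth _ _ ν.smooth ξ.2.1, by
      refine ξ.2.2.congr ?_
      filter_upwards [ae_mem_boundary] with x hx
      have h := 𝒟.clifford_unitary x _ (ν.unit x hx) (ξ.toSection x) (ξ.toSection x)
      rw [inner_self_eq_norm_sq_to_K, inner_self_eq_norm_sq_to_K] at h
      exact_mod_cast h.symm⟩
  map_add' ξ ζ := Subtype.ext (funext fun x => map_add (𝒟.clifford x (ν.field x)) _ _)
  map_smul' c ξ := Subtype.ext (funext fun x => map_smul (𝒟.clifford x (ν.field x)) c _)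

lemma inner_normalMul (ξ ζ : 𝒟.PreBoundarySpace) :
    ⟪𝒟.normalMul ν ξ, 𝒟.normalMul ν ζ⟫_ℂ = ⟪ξ, ζ⟫_ℂ := by
  refine MeasureTheory.integral_congr_ae ?_
  filter_upwards [ae_mem_boundary] with x hx
  exact 𝒟.clifford_unitary x _ (ν.unit x hx) (ξ.toSection x) (ζ.toSection x)

lemma inner_normalMul_sq (ξ ζ : 𝒟.PreBoundarySpace) :
    ⟪𝒟.normalMul ν (𝒟.normalMul ν ξ), ζ⟫_ℂ = -⟪ξ, ζ⟫_ℂ := by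
  rw [← inner_neg_left]
  refine MeasureTheory.integral_congr_ae ?_
  filter_upwards [ae_mem_boundary] with x hx
  have h := 𝒟.clifford_relation x (ν.field x) (ν.field x) (ξ.toSection x)
  rw [real_inner_self_eq_norm_sq, ν.unit x hx, ← two_smul ℝ, one_pow, mul_one, neg_smul,
    ← smul_neg] at h
  have h' := smul_right_injective (S x) (two_ne_zero (α := ℝ)) h
  exact congrArg (fun s => ⟪s, ζ.toSection x⟫_ℂ) h'

lemma norm_normalMul_le (ξ : 𝒟.PreBoundarySpace) : ‖𝒟.normalMul ν ξ‖ ≤ 1 * ‖ξ‖ := by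
  have h : ‖𝒟.normalMul ν ξ‖ ^ 2 = ‖ξ‖ ^ 2 := by
    have := 𝒟.inner_normalMul ν ξ ξ
    rw [inner_self_eq_norm_sq_to_K, inner_self_eq_norm_sq_to_K] at this
    exact_mod_cast this
  rw [one_mul]
  exact ((sq_eq_sq₀ (norm_nonneg _) (norm_nonneg _)).1 h).le

/-- The complex structure `J_D` of the space of boundary data: Clifford multiplication by the inward
unit normal, extended from smooth sections by continuity. -/
def boundaryJ : 𝒟.BoundarySpace →L[ℂ] 𝒟.BoundarySpace :=
  ((𝒟.normalMul ν).mkContinuous 1 (𝒟.norm_normalMul_le ν)).completion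

lemma boundaryJ_coe (ξ : 𝒟.PreBoundarySpace) :
    𝒟.boundaryJ ν (ξ : 𝒟.BoundarySpace) = (𝒟.normalMul ν ξ : 𝒟.PreBoundarySpace) :=
  ContinuousLinearMap.completion_apply_coe _ ξ

/-- The symplectic-Hermitian structure of the boundary data of a Dirac bundle, with
`ω(φ, ψ) = ∫_∂M ⟪ν · φ, ψ⟫`, the boundary form of the Dirac operator. -/
def boundaryStructure : CompatibleStructure 𝒟.BoundarySpace where
  J := 𝒟.boundaryJ ν
  sq φ := by
    refine UniformSpace.Completion.induction_on φ (isClosed_eq (by fun_prop) (by fun_prop)) ?_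
    intro ξ
    refine ext_inner_right ℂ fun ψ => ?_
    refine UniformSpace.Completion.induction_on ψ (isClosed_eq (by fun_prop) (by fun_prop)) ?_
    intro ζ
    rw [boundaryJ_coe, boundaryJ_coe, inner_neg_left, UniformSpace.Completion.inner_coe,
      UniformSpace.Completion.inner_coe, inner_normalMul_sq]
  isometry φ ψ := by
    refine UniformSpace.Completion.induction_on₂ φ ψ
      (isClosed_eq (by fun_prop) (by fun_prop)) ?_
    intro ξ ζ
    rw [boundaryJ_coe, boundaryJ_coe, UniformSpace.Completion.inner_coe,
      UniformSpace.Completion.inner_coe, inner_normalMul]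

end DiracBundle

end Dirac

/-!
The theorem is a statement about the Hilbert space of boundary data, its complex structure `J` and
the polarization; the geometry of the Dirac bundle enters only through `J² = -1` and the isometry of
`J`. It is proved for every complex Hilbert space `H` with such data
(`Polarization.isLagrangianSubmanifold_ellipticSelfAdjoint`).

*Manifold.* For `p`, `q` in the Grassmannian write the identity of `H = p ⊕ pᗮ = q ⊕ qᗮ` in
blocks `a`, `b`, `c`, `d`. The graph of `T : p → pᗮ` is the graph of an operator on `q` exactly
if `a + b T` is invertible, and that operator is `(c + d T) (a + b T)⁻¹`
(`graphSubspace_eq_iff`). The first is an open condition, and the second is a smooth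
Hilbert–Schmidt valued function of `T` because `c` is Hilbert–Schmidt
(`Polarization.isHilbertSchmidt_projBlock`). Graphs of Hilbert–Schmidt operators stay in the
Grassmannian because a Hilbert–Schmidt perturbation of a Fredholm operator is Fredholm
(`IsHilbertSchmidt.isFredholm_add`).

*Symplectic form.* By `Ω_W(A, B) = Im ⟪A, B⟫`, the form is the imaginary part of a Hermitian
metric. In graph coordinates around `p` that metric is the Fubini–Study metric
`Tr ((1 + X†X)⁻¹ A† (1 + X X†)⁻¹ B)` at the point `X` (`localForm_grForm`), a smooth function.
Its derivative is a sum of four values of a cubic form `u` and its conjugate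
(`hasDerivAt_fubiniStudy`), arranged so that the imaginary parts cancel in the cyclic sum: the
metric is Kähler.

*Lagrangian.* At a Lagrangian subspace `p` the operator `J` exchanges `p` and `pᗮ`, and the
graph of `T` is Lagrangian if and only if `T` is fixed by the antiunitary involution
`T ↦ J T† J` (`isLagrangian_grChart_iff`). In graph coordinates the self-adjoint elliptic
subspaces are therefore a closed real linear subspace, the fixed space of a conjugation, and
such a fixed space is its own orthogonal for `Im ⟪·, ·⟫`
(`mem_fixedSubmodule_iff_forall_grForm`).
-/

/-! ### Operations on Hilbert–Schmidt operators -/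

section HilbertSchmidtOperators

open ContinuousLinearMap

variable {E F G : Type*} [NormedAddCommGroup E] [InnerProductSpace ℂ E] [CompleteSpace E]
  [NormedAddCommGroup F] [InnerProductSpace ℂ F]
  [NormedAddCommGroup G] [InnerProductSpace ℂ G]

lemma enorm_sq_eq_ofReal {V : Type*} [SeminormedAddCommGroup V] (x : V) :
    ‖x‖ₑ ^ 2 = ENNReal.ofReal (‖x‖ ^ 2) := by
  rw [ENNReal.ofReal_pow (norm_nonneg _), ofReal_norm]

omit [CompleteSpace E] in
lemma HilbertBasis.enorm_sq_eq_tsum {ι : Type*} (b : HilbertBasis ι ℂ E) (x : E) :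
    ‖x‖ₑ ^ 2 = ∑' i, ‖⟪b i, x⟫_ℂ‖ₑ ^ 2 := by
  have h : HasSum (fun i => ‖⟪b i, x⟫_ℂ‖ ^ 2) (‖x‖ ^ 2) := by
    have h0 := (b.hasSum_inner_mul_inner x x).mapL Complex.reCLM
    convert! h0 using 1
    · ext i
      rw [← inner_conj_symm x (b i), ← Complex.normSq_eq_conj_mul_self]
      simp only [Complex.normSq_eq_norm_sq, Complex.reCLM_apply, Complex.ofReal_re]
    · rw [inner_self_eq_norm_sq_to_K]
      simp [← Complex.ofReal_pow]
  simp only [enorm_sq_eq_ofReal]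
  rw [← h.tsum_eq, ENNReal.ofReal_tsum_of_nonneg (fun i => by positivity) h.summable]

lemma isHilbertSchmidt_iff_tsum_ne_top (T : E →L[ℂ] F) :
    IsHilbertSchmidt T ↔ ∑' i, ‖T (onb E i)‖ₑ ^ 2 ≠ ⊤ := by
  simp only [enorm_sq_eq_ofReal]
  refine ⟨fun h => h.tsum_ofReal_ne_top, fun h => ?_⟩
  have := ENNReal.summable_toReal h
  refine this.congr fun i => ?_
  rw [ENNReal.toReal_ofReal (by positivity)]

/-- Passing to the adjoint does not change the sum of squares: expand both sides in matrix entries.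
As `b` and `c` are arbitrary, the sum does not depend on the basis either. -/
lemma tsum_enorm_sq_adjoint [CompleteSpace F] {ι κ : Type*} (b : HilbertBasis ι ℂ E)
    (c : HilbertBasis κ ℂ F) (T : E →L[ℂ] F) :
    ∑' j, ‖T.adjoint (c j)‖ₑ ^ 2 = ∑' i, ‖T (b i)‖ₑ ^ 2 := by
  simp only [b.enorm_sq_eq_tsum, c.enorm_sq_eq_tsum]
  rw [ENNReal.tsum_comm]
  refine tsum_congr fun i => tsum_congr fun j => ?_
  rw [adjoint_inner_right, ← inner_conj_symm, enorm_eq_nnnorm, enorm_eq_nnnorm, RCLike.nnnorm_conj]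

lemma HS.hasSum_norm_sq (T : HS E F) : HasSum (fun i => ‖T.op (onb E i)‖ ^ 2) (‖T‖ ^ 2) := by
  have := lp.hasSum_norm (p := 2) (by norm_num) (HS.toLp T)
  simp only [ENNReal.toReal_ofNat, Real.rpow_ofNat] at this
  exact this

lemma HS.enorm_sq_eq_tsum (T : HS E F) : ‖T‖ₑ ^ 2 = ∑' i, ‖T.op (onb E i)‖ₑ ^ 2 := by
  have h := T.hasSum_norm_sq
  simp only [enorm_sq_eq_ofReal]
  rw [← h.tsum_eq, ENNReal.ofReal_tsum_of_nonneg (fun i => by positivity) h.summable]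

lemma HS.ext {S T : HS E F} (h : ∀ x, S.op x = T.op x) : S = T :=
  HS.op_injective (ContinuousLinearMap.ext h)

/-- A bounded operator that is Hilbert–Schmidt, as an element of `J₂(E, F)`. -/
def HS.mk (T : E →L[ℂ] F) (hT : IsHilbertSchmidt T) : HS E F := ⟨T, hT⟩

@[simp] lemma HS.op_mk (T : E →L[ℂ] F) (hT : IsHilbertSchmidt T) : (HS.mk T hT).op = T := rfl

lemma IsHilbertSchmidt.adjoint [CompleteSpace F] {T : E →L[ℂ] F} (hT : IsHilbertSchmidt T) :
    IsHilbertSchmidt T.adjoint := by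
  rw [isHilbertSchmidt_iff_tsum_ne_top] at *
  rwa [tsum_enorm_sq_adjoint (onb E)]

lemma IsHilbertSchmidt.comp_left {T : E →L[ℂ] F} (hT : IsHilbertSchmidt T) (B : F →L[ℂ] G) :
    IsHilbertSchmidt (B ∘L T) := by
  refine Summable.of_nonneg_of_le (fun i => by positivity) (fun i => ?_)
    (Summable.mul_left (‖B‖ ^ 2) hT)
  rw [← mul_pow]
  exact pow_le_pow_left₀ (norm_nonneg _) (B.le_opNorm _) 2

/-- The adjoint, as a map on Hilbert–Schmidt operators. -/
def HS.adj [CompleteSpace F] (T : HS E F) : HS F E := HS.mk T.op.adjoint T.isHilbertSchmidt.adjoint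

@[simp] lemma HS.op_adj [CompleteSpace F] (T : HS E F) : T.adj.op = T.op.adjoint := rfl

@[simp] lemma HS.adj_adj [CompleteSpace F] (T : HS E F) : T.adj.adj = T :=
  HS.op_injective (by simp)

lemma HS.adj_add [CompleteSpace F] (S T : HS E F) : (S + T).adj = S.adj + T.adj :=
  HS.op_injective (by simp)

lemma HS.adj_smul [CompleteSpace F] (c : ℂ) (T : HS E F) :
    (c • T).adj = (starRingEnd ℂ c) • T.adj :=
  HS.op_injective (by simp only [op_adj, map_smul, map_smulₛₗ])

lemma HS.adj_sub [CompleteSpace F] (S T : HS E F) : (S - T).adj = S.adj - T.adj :=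
  HS.op_injective (by simp)

@[simp] lemma HS.norm_adj [CompleteSpace F] (T : HS E F) : ‖T.adj‖ = ‖T‖ := by
  have h : ‖T.adj‖ₑ ^ 2 = ‖T‖ₑ ^ 2 := by
    rw [HS.enorm_sq_eq_tsum, HS.enorm_sq_eq_tsum, HS.op_adj, tsum_enorm_sq_adjoint (onb E)]
  rw [enorm_sq_eq_ofReal, enorm_sq_eq_ofReal,
    ENNReal.ofReal_eq_ofReal_iff (by positivity) (by positivity)] at h
  exact (sq_eq_sq₀ (norm_nonneg _) (norm_nonneg _)).1 h

/-- The adjoint is antiunitary. -/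
lemma HS.inner_adj_adj [CompleteSpace F] (S T : HS E F) : ⟪S.adj, T.adj⟫_ℂ = ⟪T, S⟫_ℂ := by
  have h1 : Complex.I • S.adj = -(Complex.I • S).adj := by rw [HS.adj_smul]; simp
  have h2 : Complex.I • T.adj = -(Complex.I • T).adj := by rw [HS.adj_smul]; simp
  -- Polarization reduces this to `‖T†‖ = ‖T‖`; the adjoint is conjugate-linear, so it exchanges the
  -- two imaginary terms.
  rw [← inner_conj_symm T S, inner_eq_sum_norm_sq_div_four, inner_eq_sum_norm_sq_div_four S T]
  simp only [RCLike.I_to_complex, h2]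
  rw [← sub_eq_add_neg, sub_neg_eq_add]
  simp only [← HS.adj_add, ← HS.adj_sub, HS.norm_adj]
  simp only [map_div₀, map_add, map_mul, map_sub, map_pow, Complex.coe_algebraMap,
    Complex.conj_ofReal, Complex.conj_I, map_ofNat]
  ring

/-- Composition with a bounded operator on the left. -/
def HS.lcomp (B : F →L[ℂ] G) (T : HS E F) : HS E G :=
  HS.mk (B ∘L T.op) (T.isHilbertSchmidt.comp_left B)

@[simp] lemma HS.op_lcomp (B : F →L[ℂ] G) (T : HS E F) : (HS.lcomp B T).op = B ∘L T.op := rfl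

lemma HS.norm_lcomp_le (B : F →L[ℂ] G) (T : HS E F) : ‖HS.lcomp B T‖ ≤ ‖B‖ * ‖T‖ := by
  have h : ‖HS.lcomp B T‖ₑ ^ 2 ≤ (‖B‖ₑ * ‖T‖ₑ) ^ 2 := by
    rw [mul_pow, HS.enorm_sq_eq_tsum, HS.enorm_sq_eq_tsum, ← ENNReal.tsum_mul_left]
    refine ENNReal.tsum_le_tsum fun i => ?_
    rw [← mul_pow]
    gcongr
    exact B.le_opENorm _
  have h2 := (ENNReal.pow_le_pow_left_iff (two_ne_zero)).1 h
  rw [← ofReal_norm, ← ofReal_norm, ← ofReal_norm,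
    ← ENNReal.ofReal_mul (norm_nonneg _), ENNReal.ofReal_le_ofReal_iff (by positivity)] at h2
  exact h2

lemma HS.inner_eq_tsum (S T : HS E F) : ⟪S, T⟫_ℂ = ∑' i, ⟪S.op (onb E i), T.op (onb E i)⟫_ℂ := rfl

lemma HS.inner_lcomp_left [CompleteSpace F] [CompleteSpace G] (B : F →L[ℂ] G) (S : HS E F)
    (T : HS E G) : ⟪HS.lcomp B S, T⟫_ℂ = ⟪S, HS.lcomp B.adjoint T⟫_ℂ := by
  rw [HS.inner_eq_tsum, HS.inner_eq_tsum]
  exact tsum_congr fun i => by simp [adjoint_inner_right]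

variable [CompleteSpace F] [CompleteSpace G]

lemma IsHilbertSchmidt.comp_right {T : F →L[ℂ] G} (hT : IsHilbertSchmidt T) (A : E →L[ℂ] F) :
    IsHilbertSchmidt (T ∘L A) := by
  have := (hT.adjoint.comp_left A.adjoint).adjoint
  rwa [adjoint_comp, adjoint_adjoint, adjoint_adjoint] at this

/-- Composition with a bounded operator on the right. -/
def HS.rcomp (T : HS F G) (A : E →L[ℂ] F) : HS E G :=
  HS.mk (T.op ∘L A) (T.isHilbertSchmidt.comp_right A)

@[simp] lemma HS.op_rcomp (T : HS F G) (A : E →L[ℂ] F) : (HS.rcomp T A).op = T.op ∘L A := rfl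

lemma HS.adj_rcomp (T : HS F G) (A : E →L[ℂ] F) :
    (HS.rcomp T A).adj = HS.lcomp A.adjoint T.adj :=
  HS.op_injective (by simp [adjoint_comp])

lemma HS.norm_rcomp_le (T : HS F G) (A : E →L[ℂ] F) : ‖HS.rcomp T A‖ ≤ ‖T‖ * ‖A‖ := by
  rw [← HS.norm_adj, HS.adj_rcomp, mul_comm, ← HS.norm_adj T]
  refine (HS.norm_lcomp_le _ _).trans_eq ?_
  rw [LinearIsometryEquiv.norm_map]

lemma HS.inner_rcomp_left (S : HS F G) (A : E →L[ℂ] F) (T : HS E G) :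
    ⟪HS.rcomp S A, T⟫_ℂ = ⟪S, HS.rcomp T A.adjoint⟫_ℂ := by
  rw [← HS.inner_adj_adj T, HS.adj_rcomp, ← HS.inner_adj_adj _ S, HS.adj_rcomp, adjoint_adjoint,
    HS.inner_lcomp_left]

omit [CompleteSpace F] [CompleteSpace G] in
lemma HS.isBoundedBilinearMap_lcomp :
    IsBoundedBilinearMap ℝ fun p : (F →L[ℂ] G) × HS E F => HS.lcomp p.1 p.2 where
  add_left B C T := HS.ext fun x => by simp
  smul_left c B T := HS.ext fun x => rfl
  add_right B S T := HS.ext fun x => by simp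
  smul_right c B T := HS.ext fun x => by
    change B ((c : ℂ) • T.op x) = (c : ℂ) • B (T.op x)
    simp
  bound := ⟨1, one_pos, fun B T => by simpa using HS.norm_lcomp_le B T⟩

lemma HS.isBoundedBilinearMap_rcomp :
    IsBoundedBilinearMap ℝ fun p : HS F G × (E →L[ℂ] F) => HS.rcomp p.1 p.2 where
  add_left S T A := HS.ext fun x => by simp
  smul_left c T A := HS.ext fun x => rfl
  add_right T A B := HS.ext fun x => by simp
  smul_right c T A := HS.ext fun x => by
    change T.op ((c : ℂ) • A x) = (c : ℂ) • T.op (A x)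
    simp
  bound := ⟨1, one_pos, fun T A => by simpa using HS.norm_rcomp_le T A⟩

omit [CompleteSpace F] [CompleteSpace G] in
lemma ContDiffAt.hs_lcomp {V : Type*} [NormedAddCommGroup V] [NormedSpace ℝ V] {n : WithTop ℕ∞}
    {x : V} {B : V → F →L[ℂ] G} {T : V → HS E F} (hB : ContDiffAt ℝ n B x)
    (hT : ContDiffAt ℝ n T x) :
    ContDiffAt ℝ n (fun y => HS.lcomp (B y) (T y)) x :=
  ContDiffAt.comp x (g := fun p : (F →L[ℂ] G) × HS E F => HS.lcomp p.1 p.2)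
    HS.isBoundedBilinearMap_lcomp.contDiff.contDiffAt (hB.prodMk hT)

lemma ContDiffAt.hs_rcomp {V : Type*} [NormedAddCommGroup V] [NormedSpace ℝ V] {n : WithTop ℕ∞}
    {x : V} {T : V → HS F G} {A : V → E →L[ℂ] F} (hT : ContDiffAt ℝ n T x)
    (hA : ContDiffAt ℝ n A x) :
    ContDiffAt ℝ n (fun y => HS.rcomp (T y) (A y)) x :=
  ContDiffAt.comp x (g := fun p : HS F G × (E →L[ℂ] F) => HS.rcomp p.1 p.2)
    HS.isBoundedBilinearMap_rcomp.contDiff.contDiffAt (hT.prodMk hA)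

omit [CompleteSpace F] [CompleteSpace G] in
lemma HasDerivAt.hs_lcomp {B : ℝ → F →L[ℂ] G} {T : ℝ → HS E F} {B' : F →L[ℂ] G} {T' : HS E F}
    {t : ℝ} (hB : HasDerivAt B B' t) (hT : HasDerivAt T T' t) :
    HasDerivAt (fun s => HS.lcomp (B s) (T s)) (HS.lcomp (B t) T' + HS.lcomp B' (T t)) t := by
  have h := (HS.isBoundedBilinearMap_lcomp (E := E) (F := F) (G := G)).hasFDerivAt (B t, T t)
  have h' := h.comp_hasDerivAt t (hB.prodMk hT)
  exact h'

lemma HasDerivAt.hs_rcomp {T : ℝ → HS F G} {A : ℝ → E →L[ℂ] F} {T' : HS F G} {A' : E →L[ℂ] F}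
    {t : ℝ} (hT : HasDerivAt T T' t) (hA : HasDerivAt A A' t) :
    HasDerivAt (fun s => HS.rcomp (T s) (A s)) (HS.rcomp (T t) A' + HS.rcomp T' (A t)) t := by
  have h := (HS.isBoundedBilinearMap_rcomp (E := E) (F := F) (G := G)).hasFDerivAt (T t, A t)
  have h' := h.comp_hasDerivAt t (hT.prodMk hA)
  exact h'

omit [CompleteSpace G] in
/-- The Hilbert–Schmidt norm dominates the operator norm: the coordinates of `T† y` in the basis
`e` are the numbers `⟪T eᵢ, y⟫`, up to conjugation. -/
lemma HS.norm_op_le (T : HS E F) : ‖T.op‖ ≤ ‖T‖ := by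
  rw [← LinearIsometryEquiv.norm_map adjoint T.op]
  refine opNorm_le_bound _ (norm_nonneg _) fun y => ?_
  have h : ‖T.op.adjoint y‖ₑ ^ 2 ≤ (‖T‖ₑ * ‖y‖ₑ) ^ 2 := by
    rw [mul_pow, HS.enorm_sq_eq_tsum, ← ENNReal.tsum_mul_right, (onb E).enorm_sq_eq_tsum]
    refine ENNReal.tsum_le_tsum fun i => ?_
    rw [adjoint_inner_right, ← mul_pow]
    gcongr
    rw [← ofReal_norm, ← ofReal_norm, ← ofReal_norm,
      ← ENNReal.ofReal_mul (norm_nonneg _)]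
    exact ENNReal.ofReal_le_ofReal (norm_inner_le_norm _ _)
  have h2 := (ENNReal.pow_le_pow_left_iff (two_ne_zero)).1 h
  rw [← ofReal_norm, ← ofReal_norm, ← ofReal_norm,
    ← ENNReal.ofReal_mul (norm_nonneg _), ENNReal.ofReal_le_ofReal_iff (by positivity)] at h2
  exact h2

/-- The inclusion of `J₂(E, F)` into the bounded operators is continuous. -/
def HS.opL : HS E F →L[ℂ] E →L[ℂ] F :=
  HS.op.mkContinuous 1 fun T => by simpa using HS.norm_op_le T

/-- The adjoint as a bounded map; it is conjugate-linear, so only the real structure is kept. -/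
def HS.adjL : HS E F →L[ℝ] HS F E :=
  LinearMap.mkContinuous
    { toFun := HS.adj
      map_add' := HS.adj_add
      map_smul' := fun c T => by
        have := HS.adj_smul (c : ℂ) T
        rwa [Complex.conj_ofReal] at this } 1 fun T => by simp

omit [CompleteSpace F] [CompleteSpace G] in
lemma IsHilbertSchmidt.of_finiteDimensional [FiniteDimensional ℂ E] (T : E →L[ℂ] F) :
    IsHilbertSchmidt T := by
  have : Finite (OnbIndex E) := (onb E).orthonormal.linearIndependent.finite
  exact Summable.of_finite

omit [CompleteSpace G] in
lemma IsHilbertSchmidt.of_hasFiniteRange {T : E →L[ℂ] F}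
    (hT : (T : E →ₗ[ℂ] F).HasFiniteRange) : IsHilbertSchmidt T := by
  have : FiniteDimensional ℂ (T : E →ₗ[ℂ] F).range := .of_fg hT
  exact ((IsHilbertSchmidt.of_finiteDimensional
    (ContinuousLinearMap.id ℂ (T : E →ₗ[ℂ] F).range)).comp_left
      (T : E →ₗ[ℂ] F).range.subtypeL).comp_right
      (T.codRestrict (T : E →ₗ[ℂ] F).range fun x => LinearMap.mem_range_self _ x)

omit [CompleteSpace F] [CompleteSpace G] in
lemma IsHilbertSchmidt.add {S T : E →L[ℂ] F} (hS : IsHilbertSchmidt S) (hT : IsHilbertSchmidt T) :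
    IsHilbertSchmidt (S + T) := (hsSubmodule E F).add_mem hS hT

omit [CompleteSpace F] [CompleteSpace G] in
lemma IsHilbertSchmidt.neg {T : E →L[ℂ] F} (hT : IsHilbertSchmidt T) :
    IsHilbertSchmidt (-T) := (hsSubmodule E F).neg_mem hT

end HilbertSchmidtOperators

/-! ### Fredholm operators and their Hilbert–Schmidt perturbations -/

section FredholmPerturbation

open ContinuousLinearMap LinearMap.FiniteRangeSetoid

variable {E F : Type*} [NormedAddCommGroup E] [InnerProductSpace ℂ E] [CompleteSpace E]
  [NormedAddCommGroup F] [InnerProductSpace ℂ F] [CompleteSpace F]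

/-- A Hilbert–Schmidt operator is within operator norm distance `1` of an operator of finite rank:
project to the span of finitely many basis vectors first. -/
lemma IsHilbertSchmidt.exists_hasFiniteRange_norm_sub_lt {T : E →L[ℂ] F}
    (hT : IsHilbertSchmidt T) :
    ∃ N : E →L[ℂ] F, (N : E →ₗ[ℂ] F).HasFiniteRange ∧ ‖T - N‖ < 1 := by
  classical
  have h := ((summable_iff_vanishing_norm.1 hT) (1 / 4) (by norm_num))
  obtain ⟨s, hs⟩ := h
  let N : E →L[ℂ] F := ∑ i ∈ s, (innerSL ℂ (onb E i)).smulRight (T (onb E i))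
  have hN : ∀ i, N (onb E i) = if i ∈ s then T (onb E i) else 0 := by
    intro i
    simp only [N, sum_apply, smulRight_apply, innerSL_apply_apply]
    simp only [(orthonormal_iff_ite.1 (onb E).orthonormal), ite_smul, one_smul, zero_smul]
    rw [Finset.sum_ite_eq' s i]
  have hNf : (N : E →ₗ[ℂ] F).HasFiniteRange := by
    have : (N : E →ₗ[ℂ] F) ∈ LinearMap.finiteRange ℂ E F := by
      have : (N : E →ₗ[ℂ] F) = ∑ i ∈ s,
          (((innerSL ℂ (onb E i)).smulRight (T (onb E i)) : E →L[ℂ] F) : E →ₗ[ℂ] F) := by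
        ext x; simp [N]
      rw [this]
      refine Submodule.sum_mem _ fun i _ => ?_
      rw [LinearMap.mem_finiteRange_iff_hasFiniteRange]
      have h : (((innerSL ℂ (onb E i)).smulRight (T (onb E i)) : E →L[ℂ] F) : E →ₗ[ℂ] F)
          = (LinearMap.toSpanSingleton ℂ F (T (onb E i))) ∘ₗ (innerSL ℂ (onb E i) : E →ₗ[ℂ] ℂ) := by
        ext x; simp
      rw [h]
      exact LinearMap.HasFiniteRange.of_finite_dom.comp_right _
    rwa [LinearMap.mem_finiteRange_iff_hasFiniteRange] at this
  refine ⟨N, hNf, ?_⟩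
  have hNT : IsHilbertSchmidt (T - N) := by
    rw [sub_eq_add_neg]; exact hT.add (IsHilbertSchmidt.of_hasFiniteRange hNf).neg
  let D : HS E F := HS.mk (T - N) hNT
  have hD : ‖D‖ ^ 2 ≤ 1 / 4 := by
    refine hasSum_le_of_sum_le D.hasSum_norm_sq fun t => ?_
    have hD : ∀ i, ‖D.op (onb E i)‖ ^ 2 = if i ∈ s then 0 else ‖T (onb E i)‖ ^ 2 := by
      intro i
      simp only [D, HS.op_mk, sub_apply, hN]
      split_ifs <;> simp
    have ht := hs (t \ s) Finset.sdiff_disjoint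
    rw [Finset.sum_congr rfl fun i _ => hD i, Finset.sum_ite, Finset.sum_const_zero, zero_add,
      Finset.filter_notMem_eq_sdiff]
    exact ((le_abs_self _).trans_lt ht).le
  have h1 : ‖D‖ < 1 := by nlinarith [norm_nonneg D]
  exact (HS.norm_op_le D).trans_lt h1

omit [CompleteSpace F] in
/-- Hilbert–Schmidt perturbations preserve the Fredholm property: for a quasi-inverse `v` of `u`,
the operator `v (u + K)` agrees up to finite rank with an invertible one. -/
lemma IsHilbertSchmidt.isFredholm_add {u K : E →L[ℂ] F} (hu : u.IsFredholm)
    (hK : IsHilbertSchmidt K) : (u + K).IsFredholm := by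
  obtain ⟨v, hv⟩ := hu.exists_isQuasiInverse
  obtain ⟨N, hN, hlt⟩ := (hK.comp_left v).exists_hasFiniteRange_norm_sub_lt
  have hunit : IsUnit (1 + (v ∘L K - N)) := by
    rw [← sub_neg_eq_add]
    exact isUnit_one_sub_of_norm_lt_one (by rwa [norm_neg])
  let e : E ≃L[ℂ] E := ContinuousLinearEquiv.unitsEquiv ℂ E hunit.unit
  have he : ∀ x, e x = x + (v (K x) - N x) := fun x => rfl
  have hw : ((e.symm : E →L[ℂ] E) : E →ₗ[ℂ] E).IsQuasiInverse
      ((v : F →ₗ[ℂ] E) ∘ₗ ((u + K : E →L[ℂ] F) : E →ₗ[ℂ] F)) := by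
    refine (e.toLinearEquiv.isQuasiInverse).congr (Setoid.refl _) ?_
    have h1 := equiv_iff_hasFiniteRange.1 hv.1
    rw [equiv_iff_hasFiniteRange]
    have h2 : (v : F →ₗ[ℂ] E) ∘ₗ ((u + K : E →L[ℂ] F) : E →ₗ[ℂ] F) -
        (e.toLinearEquiv : E →ₗ[ℂ] E) =
        ((v : F →ₗ[ℂ] E) ∘ₗ (u : E →ₗ[ℂ] F) - LinearMap.id) + (N : E →ₗ[ℂ] E) := by
      ext x
      change v (u x + K x) - e x = (v (u x) - x) + N x
      rw [he, map_add]
      abel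
    have h3 := h1.add hN
    rwa [← h2] at h3
  have := LinearMap.IsQuasiInverse.of_comp_right hv.symm hw
  exact IsFredholm.of_isQuasiInverse (v := (e.symm : E →L[ℂ] E) ∘L v) this

lemma ContinuousLinearMap.isUnit_one_add_adjoint_comp (S : E →L[ℂ] F) :
    IsUnit (1 + S.adjoint ∘L S) := by
  refine isUnit_of_forall_le_norm_inner_map _ one_pos fun x => ?_
  have h : ⟪(1 + S.adjoint ∘L S) x, x⟫_ℂ = ((‖x‖ ^ 2 + ‖S x‖ ^ 2 : ℝ) : ℂ) := by
    simp [adjoint_inner_left, inner_self_eq_norm_sq_to_K]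
  rw [h, Complex.norm_real, Real.norm_of_nonneg (by positivity)]
  simp only [NNReal.coe_one, mul_one]
  nlinarith [sq_nonneg ‖S x‖]

end FredholmPerturbation

/-! ### Graphs over closed subspaces -/

section Graphs

open ContinuousLinearMap

variable {H : Type*} [NormedAddCommGroup H] [InnerProductSpace ℂ H]

/-- The orthogonal projection of `H` onto `V`, restricted to `U`. For `U`, `V` ranging over two
subspaces and their orthogonal complements these are the blocks of the identity of `H`. -/
def Submodule.projBlock (U V : Submodule ℂ H) [V.HasOrthogonalProjection] : U →L[ℂ] V :=
  V.orthogonalProjectionOnto ∘L U.subtypeL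

@[simp] lemma Submodule.projBlock_apply (U V : Submodule ℂ H) [V.HasOrthogonalProjection] (x : U) :
    U.projBlock V x = V.orthogonalProjectionOnto (x : H) := rfl

lemma Submodule.adjoint_projBlock (U V : Submodule ℂ H) [CompleteSpace U] [CompleteSpace V] :
    (U.projBlock V).adjoint = V.projBlock U := by
  symm
  rw [eq_adjoint_iff]
  intro x y
  simp

variable [CompleteSpace H]

lemma mem_graphSubspace_iff (W : ClosedSubmodule ℂ H) (T : W.toSubmodule →L[ℂ] W.toSubmoduleᗮ)
    (v : H) :
    v ∈ graphSubspace W T ↔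
      W.toSubmoduleᗮ.orthogonalProjectionOnto v = T (W.toSubmodule.orthogonalProjectionOnto v) := by
  constructor
  · rintro ⟨x, rfl⟩
    have h1 : W.toSubmodule.orthogonalProjectionOnto (T x : H) = 0 :=
      Submodule.orthogonalProjectionOnto_eq_zero_iff.2 (T x).2
    have h2 : W.toSubmoduleᗮ.orthogonalProjectionOnto (x : H) = 0 :=
      Submodule.orthogonalProjectionOnto_eq_zero_iff.2 (Submodule.le_orthogonal_orthogonal _ x.2)
    simp [h1, h2]
  · intro h
    refine ⟨W.toSubmodule.orthogonalProjectionOnto v, ?_⟩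
    change (W.toSubmodule.orthogonalProjectionOnto v : H) +
      T (W.toSubmodule.orthogonalProjectionOnto v) = v
    rw [← h]
    exact W.toSubmodule.starProjection_add_starProjection_orthogonal v

lemma add_mem_graphSubspace (W : ClosedSubmodule ℂ H) (T : W.toSubmodule →L[ℂ] W.toSubmoduleᗮ)
    (x : W.toSubmodule) : (x : H) + T x ∈ graphSubspace W T := ⟨x, rfl⟩

lemma exists_of_mem_graphSubspace {W : ClosedSubmodule ℂ H}
    {T : W.toSubmodule →L[ℂ] W.toSubmoduleᗮ}
    {v : H} (hv : v ∈ graphSubspace W T) : ∃ x : W.toSubmodule, v = (x : H) + T x := by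
  obtain ⟨x, hx⟩ := hv
  exact ⟨x, hx.symm⟩

lemma orthogonalProjectionOnto_graph (W : ClosedSubmodule ℂ H) (x : W.toSubmodule)
    (y : W.toSubmoduleᗮ) :
    W.toSubmodule.orthogonalProjectionOnto ((x : H) + y) = x := by
  have h1 : W.toSubmodule.orthogonalProjectionOnto (y : H) = 0 :=
      Submodule.orthogonalProjectionOnto_eq_zero_iff.2 y.2
  simp [h1]

lemma orthogonalProjectionOnto_orthogonal_graph (W : ClosedSubmodule ℂ H) (x : W.toSubmodule)
    (y : W.toSubmoduleᗮ) :
    W.toSubmoduleᗮ.orthogonalProjectionOnto ((x : H) + y) = y := by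
  have h2 : W.toSubmoduleᗮ.orthogonalProjectionOnto (x : H) = 0 :=
      Submodule.orthogonalProjectionOnto_eq_zero_iff.2 (Submodule.le_orthogonal_orthogonal _ x.2)
  simp [h2]

variable (p q : ClosedSubmodule ℂ H)

/-- The component along `q` of the graph parametrization `x ↦ x + T x` of the graph of
`T : p → pᗮ`. -/
def graphBase (T : p.toSubmodule →L[ℂ] p.toSubmoduleᗮ) : p.toSubmodule →L[ℂ] q.toSubmodule :=
  p.toSubmodule.projBlock q.toSubmodule + p.toSubmoduleᗮ.projBlock q.toSubmodule ∘L T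

/-- The component along `qᗮ` of the graph parametrization `x ↦ x + T x` of the graph of
`T : p → pᗮ`. -/
def graphFibre (T : p.toSubmodule →L[ℂ] p.toSubmoduleᗮ) : p.toSubmodule →L[ℂ] q.toSubmoduleᗮ :=
  p.toSubmodule.projBlock q.toSubmoduleᗮ + p.toSubmoduleᗮ.projBlock q.toSubmoduleᗮ ∘L T

variable {p q}

lemma graphBase_apply (T : p.toSubmodule →L[ℂ] p.toSubmoduleᗮ) (x : p.toSubmodule) :
    graphBase p q T x = q.toSubmodule.orthogonalProjectionOnto ((x : H) + T x) := by
  simp [graphBase]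

lemma graphFibre_apply (T : p.toSubmodule →L[ℂ] p.toSubmoduleᗮ) (x : p.toSubmodule) :
    graphFibre p q T x = q.toSubmoduleᗮ.orthogonalProjectionOnto ((x : H) + T x) := by
  simp [graphFibre]

lemma graphBase_comp_of_graphSubspace_eq {T : p.toSubmodule →L[ℂ] p.toSubmoduleᗮ}
    {S : q.toSubmodule →L[ℂ] q.toSubmoduleᗮ} (h : graphSubspace p T = graphSubspace q S)
    (x : p.toSubmodule) :
    graphBase q p S (graphBase p q T x) = x := by
  have hx : (x : H) + T x ∈ graphSubspace q S := h ▸ add_mem_graphSubspace p T x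
  obtain ⟨z, hz⟩ := exists_of_mem_graphSubspace hx
  rw [graphBase_apply, graphBase_apply, hz, orthogonalProjectionOnto_graph, ← hz,
    orthogonalProjectionOnto_graph]

/-- The graph of `T : p → pᗮ` is the graph of `S : q → qᗮ` if and only if it projects
isomorphically to `q` and `S` is the resulting quotient of components. -/
lemma graphSubspace_eq_iff {T : p.toSubmodule →L[ℂ] p.toSubmoduleᗮ}
    {S : q.toSubmodule →L[ℂ] q.toSubmoduleᗮ} :
    graphSubspace p T = graphSubspace q S ↔
      (graphBase p q T).IsInvertible ∧ S = graphFibre p q T ∘L (graphBase p q T).inverse := by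
  constructor
  · intro h
    have hinv : (graphBase p q T).IsInvertible :=
      .of_inverse (g := graphBase q p S)
        (ContinuousLinearMap.ext (graphBase_comp_of_graphSubspace_eq h.symm))
        (ContinuousLinearMap.ext (graphBase_comp_of_graphSubspace_eq h))
    refine ⟨hinv, ?_⟩
    obtain ⟨e, he⟩ := hinv
    rw [← he, inverse_equiv]
    ext z : 1
    obtain ⟨x, rfl⟩ := e.surjective z
    have hx : (x : H) + T x ∈ graphSubspace q S := h ▸ add_mem_graphSubspace p T x
    rw [mem_graphSubspace_iff] at hx
    have hex : e x = graphBase p q T x := by rw [← he]; rfl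
    rw [ContinuousLinearMap.comp_apply, ContinuousLinearEquiv.coe_coe, e.symm_apply_apply, hex,
      graphBase_apply, graphFibre_apply, hx]
  · rintro ⟨⟨e, he⟩, hS⟩
    rw [← he, inverse_equiv] at hS
    have hex : ∀ x, e x = graphBase p q T x := fun x => by rw [← he]; rfl
    have key : ∀ x : p.toSubmodule,
        q.toSubmoduleᗮ.orthogonalProjectionOnto ((x : H) + T x) = S (e x) := by
      intro x
      rw [hS, ContinuousLinearMap.comp_apply, ContinuousLinearEquiv.coe_coe, e.symm_apply_apply,
        graphFibre_apply]
    ext v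
    constructor
    · intro hv
      obtain ⟨x, rfl⟩ := exists_of_mem_graphSubspace hv
      refine (mem_graphSubspace_iff _ _ _).2 ?_
      rw [key, hex, graphBase_apply]
    · intro hv
      obtain ⟨z, rfl⟩ := exists_of_mem_graphSubspace hv
      obtain ⟨x, rfl⟩ := e.surjective z
      have : ((e x : q.toSubmodule) : H) + S (e x) = x + T x := by
        rw [← key, hex, graphBase_apply]
        exact q.toSubmodule.starProjection_add_starProjection_orthogonal _
      rw [this]
      exact add_mem_graphSubspace p T x

lemma graphSubspace_injective : Function.Injective (graphSubspace p) := by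
  intro S T h
  ext x : 1
  have hx : (x : H) + S x ∈ graphSubspace p T := h ▸ add_mem_graphSubspace p S x
  rw [mem_graphSubspace_iff, orthogonalProjectionOnto_graph,
    orthogonalProjectionOnto_orthogonal_graph] at hx
  exact hx

lemma grChart_injective (W : ClosedSubmodule ℂ H) : Function.Injective (grChart W) :=
  graphSubspace_injective.comp HS.op_injective

lemma graphSubspace_zero (W : ClosedSubmodule ℂ H) : graphSubspace W 0 = W := by
  ext v
  refine (mem_graphSubspace_iff W 0 v).trans ?_
  rw [zero_apply, Submodule.orthogonalProjectionOnto_eq_zero_iff,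
    Submodule.orthogonal_orthogonal]
  rfl

lemma grChart_zero (W : ClosedSubmodule ℂ H) : grChart W 0 = W := by
  rw [grChart, map_zero, graphSubspace_zero]

/-- Graphs of small operators over distinct closed subspaces `p`, `q` are distinct: if `x ∈ p` is
not in `q` and `x + T x = z + S z` with `z ∈ q`, then the norm of the component of `x` along `qᗮ` is
at most `‖T x‖ + ‖S z‖`. -/
lemma exists_pos_graphSubspace_ne (h : ¬ p ≤ q) : ∃ ε > 0,
    ∀ (T : p.toSubmodule →L[ℂ] p.toSubmoduleᗮ) (S : q.toSubmodule →L[ℂ] q.toSubmoduleᗮ),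
      ‖T‖ < ε → ‖S‖ < ε → graphSubspace p T ≠ graphSubspace q S := by
  obtain ⟨x, hxp, hxq⟩ := SetLike.not_le_iff_exists.1 h
  let y := q.toSubmoduleᗮ.orthogonalProjectionOnto x
  have hy : 0 < ‖y‖ := by
    rw [norm_pos_iff]
    intro hy
    rw [Submodule.orthogonalProjectionOnto_eq_zero_iff, Submodule.orthogonal_orthogonal] at hy
    exact hxq hy
  have hx0 : 0 ≤ ‖x‖ := norm_nonneg x
  refine ⟨min 1 (‖y‖ / (3 * ‖x‖ + 1)), by positivity, fun T S hT hS heq => ?_⟩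
  have hT1 := hT.trans_le (min_le_left _ _)
  have hT2 := hT.trans_le (min_le_right _ _)
  have hS2 := hS.trans_le (min_le_right _ _)
  rw [lt_div_iff₀ (by positivity)] at hT2 hS2
  let x' : p.toSubmodule := ⟨x, hxp⟩
  have hmem : x + T x' ∈ graphSubspace q S := heq ▸ add_mem_graphSubspace p T x'
  rw [mem_graphSubspace_iff, map_add] at hmem
  have hTx : ‖(T x' : H)‖ ≤ ‖T‖ * ‖x‖ := T.le_opNorm x'
  have e1 : ‖y‖ ≤ ‖S (q.toSubmodule.orthogonalProjectionOnto (x + T x'))‖ +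
      ‖q.toSubmoduleᗮ.orthogonalProjectionOnto (T x' : H)‖ := by
    rw [← hmem]
    exact norm_le_add_norm_add _ _
  have e2 := q.toSubmoduleᗮ.norm_orthogonalProjectionOnto_apply_le (T x' : H)
  have e3 := (S.le_opNorm (q.toSubmodule.orthogonalProjectionOnto (x + T x'))).trans
    (mul_le_mul_of_nonneg_left ((q.toSubmodule.norm_orthogonalProjectionOnto_apply_le
      (x + T x')).trans (norm_add_le _ _)) (norm_nonneg S))
  have e4 : ‖S‖ * ‖(T x' : H)‖ ≤ ‖S‖ * ‖x‖ :=
    mul_le_mul_of_nonneg_left (hTx.trans (by nlinarith)) (norm_nonneg S)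
  nlinarith [norm_nonneg T, norm_nonneg S]

end Graphs

/-! ### The manifold structure of the restricted Grassmannian -/

section RestrictedGrassmannian

open ContinuousLinearMap LinearMap.FiniteRangeSetoid

variable {H : Type*} [NormedAddCommGroup H] [InnerProductSpace ℂ H] [CompleteSpace H]

/-- A closed subspace is isomorphic to the graph of an operator on it. -/
def graphEquiv (W : ClosedSubmodule ℂ H) (T : W.toSubmodule →L[ℂ] W.toSubmoduleᗮ) :
    W.toSubmodule ≃L[ℂ] (graphSubspace W T).toSubmodule :=
  .equivOfInverse
    ((W.toSubmodule.subtypeL + W.toSubmoduleᗮ.subtypeL ∘L T).codRestrict _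
      (add_mem_graphSubspace W T))
    ((graphSubspace W T).toSubmodule.projBlock W.toSubmodule)
    (fun x => orthogonalProjectionOnto_graph W x (T x))
    (fun v => by
      obtain ⟨v, hv⟩ := v
      obtain ⟨x, rfl⟩ := exists_of_mem_graphSubspace hv
      refine Subtype.ext ?_
      have h := orthogonalProjectionOnto_graph W x (T x)
      change ((W.toSubmodule.orthogonalProjectionOnto ((x : H) + T x) : W.toSubmodule) : H) +
        T (W.toSubmodule.orthogonalProjectionOnto ((x : H) + T x)) = _
      rw [h])

lemma coe_graphEquiv (W : ClosedSubmodule ℂ H) (T : W.toSubmodule →L[ℂ] W.toSubmoduleᗮ)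
    (x : W.toSubmodule) : (graphEquiv W T x : H) = x + T x := rfl

lemma subtypeL_graph (W : ClosedSubmodule ℂ H) (T : W.toSubmodule →L[ℂ] W.toSubmoduleᗮ) :
    (graphSubspace W T).toSubmodule.subtypeL =
      (W.toSubmodule.subtypeL + W.toSubmoduleᗮ.subtypeL ∘L T) ∘L
        ((graphEquiv W T).symm : (graphSubspace W T).toSubmodule →L[ℂ] W.toSubmodule) := by
  ext v
  obtain ⟨x, rfl⟩ := (graphEquiv W T).surjective v
  simp [coe_graphEquiv]

lemma ContinuousLinearMap.IsFredholm.comp_equiv {E E' F : Type*}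
    [NormedAddCommGroup E] [NormedSpace ℂ E] [NormedAddCommGroup E'] [NormedSpace ℂ E']
    [NormedAddCommGroup F] [NormedSpace ℂ F]
    {u : E →L[ℂ] F} (hu : u.IsFredholm) (e : E' ≃L[ℂ] E) : (u ∘L (e : E' →L[ℂ] E)).IsFredholm := by
  obtain ⟨v, hv⟩ := hu.exists_isQuasiInverse
  exact IsFredholm.of_isQuasiInverse (v := (e.symm : E →L[ℂ] E') ∘L v)
    ((e.toLinearEquiv.isQuasiInverse).comp hv)

variable {𝒥 : CompatibleStructure H} (P : Polarization 𝒥)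

namespace Polarization

/-- The Grassmannian contains with `W` the graph of every Hilbert–Schmidt operator on `W`. -/
lemma grChart_mem {W : ClosedSubmodule ℂ H} (hW : W ∈ P.restrictedGrassmannian) (T : GrTangent W) :
    grChart W T ∈ P.restrictedGrassmannian := by
  have hT := T.isHilbertSchmidt
  constructor
  · change (P.prPlus ∘L (graphSubspace W T.op).toSubmodule.subtypeL).IsFredholm
    rw [subtypeL_graph, ← comp_assoc, comp_add]
    refine IsFredholm.comp_equiv (IsHilbertSchmidt.isFredholm_add hW.1 ?_) _
    exact (hT.comp_left _).comp_left _
  · change IsHilbertSchmidt (P.prMinus ∘L (graphSubspace W T.op).toSubmodule.subtypeL)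
    rw [subtypeL_graph, ← comp_assoc, comp_add]
    exact (hW.2.add ((hT.comp_left _).comp_left _)).comp_right _

/-- Two points `p`, `q` of the Grassmannian differ by a Hilbert–Schmidt operator. First compare `q`
with `L₊`: if `g` is a parametrix of `pr₊ : q → L₊`, then `x = pr₊ (g x) = g x - pr₋ (g x)` up to
finite rank for `x ∈ L₊`, and the projection to `qᗮ` kills `g x`. -/
lemma isHilbertSchmidt_projBlock {p q : ClosedSubmodule ℂ H} (hp : p ∈ P.restrictedGrassmannian)
    (hq : q ∈ P.restrictedGrassmannian) :
    IsHilbertSchmidt (p.toSubmodule.projBlock q.toSubmoduleᗮ) := by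
  have hdec : ∀ x : H, (P.prPlus x : H) + P.prMinus x = x := fun x =>
    P.plus.toSubmodule.starProjection_add_starProjection_orthogonal x
  have h1 : IsHilbertSchmidt (P.plus.toSubmodule.projBlock q.toSubmoduleᗮ) := by
    obtain ⟨g, hg⟩ := hq.1.exists_isQuasiInverse
    have hfin := equiv_iff_hasFiniteRange.1 hg.2
    let N : P.plus.toSubmodule →L[ℂ] P.plus.toSubmodule :=
      (P.prPlus ∘L q.toSubmodule.subtypeL) ∘L g - ContinuousLinearMap.id ℂ _
    have hN : IsHilbertSchmidt N := IsHilbertSchmidt.of_hasFiniteRange hfin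
    have h2 := ((hq.2.comp_left P.plus.toSubmoduleᗮ.subtypeL).comp_left
      q.toSubmoduleᗮ.orthogonalProjectionOnto).comp_right g
    convert (h2.add (hN.comp_left (P.plus.toSubmodule.projBlock q.toSubmoduleᗮ))).neg using 1
    ext x : 1
    have h3 : q.toSubmoduleᗮ.orthogonalProjectionOnto (g x : H) = 0 :=
      Submodule.orthogonalProjectionOnto_eq_zero_iff.2
        (Submodule.le_orthogonal_orthogonal _ (g x).2)
    have h4 := congrArg q.toSubmoduleᗮ.orthogonalProjectionOnto (hdec (g x : H))
    rw [h3, map_add] at h4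
    simp only [N, neg_apply, add_apply, ContinuousLinearMap.comp_apply, sub_apply, map_sub,
      Submodule.projBlock_apply, Submodule.subtypeL_apply, ContinuousLinearMap.id_apply]
    rw [add_comm] at h4
    rw [← add_sub_assoc, h4]
    simp
  have h5 := h1.comp_right (P.prPlus ∘L p.toSubmodule.subtypeL)
  have h6 := (hp.2.comp_left P.plus.toSubmoduleᗮ.subtypeL).comp_left
      q.toSubmoduleᗮ.orthogonalProjectionOnto
  convert h5.add h6 using 1
  ext x : 1
  have h4 := congrArg q.toSubmoduleᗮ.orthogonalProjectionOnto (hdec (x : H))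
  rw [map_add] at h4
  exact h4.symm

end Polarization

variable {p q : ClosedSubmodule ℂ H}

/-- The change of coordinates of the Grassmannian: `T ↦ (c + d T) (a + b T)⁻¹`, where `a`, `b`, `c`,
`d` are the blocks of the identity of `H = p ⊕ pᗮ = q ⊕ qᗮ`. The block `c : p → qᗮ` is an argument,
because it has to be given as a Hilbert–Schmidt operator. -/
def graphTransition (c : HS p.toSubmodule q.toSubmoduleᗮ) (T : GrTangent p) : GrTangent q :=
  HS.rcomp (c + HS.lcomp (p.toSubmoduleᗮ.projBlock q.toSubmoduleᗮ) T)
    (graphBase p q T.op).inverse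

lemma op_graphTransition {c : HS p.toSubmodule q.toSubmoduleᗮ}
    (hc : c.op = p.toSubmodule.projBlock q.toSubmoduleᗮ) (T : GrTangent p) :
    (graphTransition c T).op = graphFibre p q T.op ∘L (graphBase p q T.op).inverse := by
  simp [graphTransition, hc, graphFibre]

variable (p q) in
/-- The overlap of the parametrizations around `p` and `q`, in the coordinates around `p`. -/
def graphOverlap : Set (GrTangent p) := {T | (graphBase p q T.op).IsInvertible}

lemma continuous_graphBase_op : Continuous fun T : GrTangent p => graphBase p q T.op :=
  continuous_const.add ((ContinuousLinearMap.compL ℂ _ _ _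
    (p.toSubmoduleᗮ.projBlock q.toSubmodule)).continuous.comp HS.opL.continuous)

lemma isOpen_graphOverlap : IsOpen (graphOverlap p q) :=
  (ContinuousLinearEquiv.isOpen (𝕜 := ℂ) (E := p.toSubmodule) (F := q.toSubmodule)).preimage
    continuous_graphBase_op

lemma grChart_graphTransition {c : HS p.toSubmodule q.toSubmoduleᗮ}
    (hc : c.op = p.toSubmodule.projBlock q.toSubmoduleᗮ) {T : GrTangent p}
    (hT : T ∈ graphOverlap p q) : grChart q (graphTransition c T) = grChart p T :=
  (graphSubspace_eq_iff.2 ⟨hT, op_graphTransition hc T⟩).symm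

lemma preimage_range_grChart {c : HS p.toSubmodule q.toSubmoduleᗮ}
    (hc : c.op = p.toSubmodule.projBlock q.toSubmoduleᗮ) :
    grChart p ⁻¹' Set.range (grChart q) = graphOverlap p q := by
  ext T
  constructor
  · rintro ⟨S, hS⟩
    exact (graphSubspace_eq_iff.1 hS.symm).1
  · exact fun hT => ⟨_, grChart_graphTransition hc hT⟩

lemma transition_eq_graphTransition {c : HS p.toSubmodule q.toSubmoduleᗮ}
    (hc : c.op = p.toSubmodule.projBlock q.toSubmoduleᗮ) {T : GrTangent p}
    (hT : T ∈ graphOverlap p q) :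
    transition (E := GrTangent (H := H)) grChart p q T = graphTransition c T := by
  rw [transition, Function.comp_apply, ← grChart_graphTransition hc hT]
  exact Function.leftInverse_invFun (grChart_injective q) _

lemma contDiffAt_graphBase_inverse {T : GrTangent p} (hT : T ∈ graphOverlap p q) :
    ContDiffAt ℝ ∞ (fun T : GrTangent p => (graphBase p q T.op).inverse) T := by
  have h1 : ContDiff ℂ ∞ fun T : GrTangent p => graphBase p q T.op :=
    contDiff_const.add (((ContinuousLinearMap.compL ℂ _ _ _
      (p.toSubmoduleᗮ.projBlock q.toSubmodule)) ∘L HS.opL).contDiff (n := ∞))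
  have h2 : IsInvertible (graphBase p q T.op) := hT
  have h3 := h2.contDiffAt_map_inverse (n := ∞)
  exact (ContDiffAt.comp T h3 h1.contDiffAt).restrict_scalars ℝ

lemma contDiffAt_graphTransition (c : HS p.toSubmodule q.toSubmoduleᗮ) {T : GrTangent p}
    (hT : T ∈ graphOverlap p q) : ContDiffAt ℝ ∞ (graphTransition c) T :=
  (contDiffAt_const.add (ContDiffAt.hs_lcomp contDiffAt_const contDiffAt_id)).hs_rcomp
    (contDiffAt_graphBase_inverse hT)

namespace Polarization

/-- The graph parametrizations make the restricted Grassmannian a Hausdorff manifold. -/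
theorem isSmoothManifold_restrictedGrassmannian :
    IsSmoothManifold (E := GrTangent (H := H)) grChart P.restrictedGrassmannian where
  centred p _ := grChart_zero p
  injective p _ := grChart_injective p
  range_subset p hp := by
    rintro _ ⟨T, rfl⟩
    exact P.grChart_mem hp T
  isOpen_overlap p hp q hq := by
    rw [preimage_range_grChart (c := HS.mk _ (P.isHilbertSchmidt_projBlock hp hq)) rfl]
    exact isOpen_graphOverlap
  smooth_transition p hp q hq := by
    rw [preimage_range_grChart (c := HS.mk _ (P.isHilbertSchmidt_projBlock hp hq)) rfl]
    intro T hT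
    refine ((contDiffAt_graphTransition (HS.mk _ (P.isHilbertSchmidt_projBlock hp hq))
      hT).contDiffWithinAt).congr (fun S hS => ?_) ?_
    · exact transition_eq_graphTransition rfl hS
    · exact transition_eq_graphTransition rfl hT
  hausdorff p _ q _ hpq := by
    have key : ∃ ε > 0, ∀ (T : p.toSubmodule →L[ℂ] p.toSubmoduleᗮ)
        (S : q.toSubmodule →L[ℂ] q.toSubmoduleᗮ),
        ‖T‖ < ε → ‖S‖ < ε → graphSubspace p T ≠ graphSubspace q S := by
      by_cases h : p ≤ q
      · obtain ⟨ε, hε, h'⟩ := exists_pos_graphSubspace_ne fun h2 => hpq (le_antisymm h h2)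
        exact ⟨ε, hε, fun T S hT hS => (h' S T hS hT).symm⟩
      · exact exists_pos_graphSubspace_ne h
    obtain ⟨ε, hε, h⟩ := key
    refine ⟨Metric.ball 0 ε, Metric.ball 0 ε, Metric.isOpen_ball, Metric.isOpen_ball,
      Metric.mem_ball_self hε, Metric.mem_ball_self hε, ?_⟩
    rw [Set.disjoint_left]
    rintro _ ⟨T, hT, rfl⟩ ⟨S, hS, hTS⟩
    rw [mem_ball_zero_iff] at hT hS
    exact h T.op S.op ((HS.norm_op_le T).trans_lt hT) ((HS.norm_op_le S).trans_lt hS) hTS.symm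

end Polarization

end RestrictedGrassmannian

/-! ### The Fubini–Study metric in graph coordinates -/

section FubiniStudy

open ContinuousLinearMap

variable {E F : Type*} [NormedAddCommGroup E] [InnerProductSpace ℂ E] [CompleteSpace E]
  [NormedAddCommGroup F] [InnerProductSpace ℂ F] [CompleteSpace F]

/-- The effect of coordinate changes `A ↦ d A g` on the Hilbert–Schmidt inner product. -/
lemma HS.inner_conjugate {E' F' : Type*} [NormedAddCommGroup E'] [InnerProductSpace ℂ E']
    [CompleteSpace E'] [NormedAddCommGroup F'] [InnerProductSpace ℂ F'] [CompleteSpace F']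
    (d : F →L[ℂ] F') (g : E' →L[ℂ] E) (A B : HS E F) :
    ⟪HS.rcomp (HS.lcomp d A) g, HS.rcomp (HS.lcomp d B) g⟫_ℂ =
      ⟪HS.rcomp A (g ∘L g.adjoint), HS.lcomp (d.adjoint ∘L d) B⟫_ℂ := by
  have h1 : HS.rcomp (HS.lcomp d A) g = HS.lcomp d (HS.rcomp A g) := HS.ext fun x => rfl
  have h2 : HS.rcomp A (g ∘L g.adjoint) = HS.rcomp (HS.rcomp A g) g.adjoint := HS.ext fun x => rfl
  have h3 : HS.rcomp (HS.lcomp (d.adjoint ∘L d) B) g =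
    HS.lcomp d.adjoint (HS.rcomp (HS.lcomp d B) g) := HS.ext fun x => rfl
  rw [h1, HS.inner_lcomp_left, h2, HS.inner_rcomp_left (HS.rcomp A g), adjoint_adjoint, h3]

/-- The operator `(1 + T†T)⁻¹`. -/
def gramInv (T : E →L[ℂ] F) : E →L[ℂ] E := Ring.inverse (1 + T.adjoint ∘L T)

lemma gramInv_mul (T : E →L[ℂ] F) : gramInv T * (1 + T.adjoint ∘L T) = 1 :=
  Ring.inverse_mul_cancel _ (isUnit_one_add_adjoint_comp T)

lemma mul_gramInv (T : E →L[ℂ] F) : (1 + T.adjoint ∘L T) * gramInv T = 1 :=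
  Ring.mul_inverse_cancel _ (isUnit_one_add_adjoint_comp T)

lemma gramInv_eq_of_mul_eq_one {T : E →L[ℂ] F} {S : E →L[ℂ] E}
    (h : (1 + T.adjoint ∘L T) * S = 1) : gramInv T = S :=
  left_inv_eq_right_inv (gramInv_mul T) h

lemma gramInv_eq_of_mul_eq_one' {T : E →L[ℂ] F} {S : E →L[ℂ] E}
    (h : S * (1 + T.adjoint ∘L T) = 1) : gramInv T = S :=
  (left_inv_eq_right_inv h (mul_gramInv T)).symm

@[simp] lemma adjoint_gramInv (T : E →L[ℂ] F) : (gramInv T).adjoint = gramInv T := by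
  symm
  refine gramInv_eq_of_mul_eq_one ?_
  have h := congrArg adjoint (gramInv_mul T)
  rw [ContinuousLinearMap.mul_def, adjoint_comp, map_add, adjoint_comp, adjoint_adjoint] at h
  have h1 : adjoint (1 : E →L[ℂ] E) = 1 := adjoint_id
  rwa [h1] at h

/-- The resolvents of `T†T` and `T T†` are intertwined by `T`. -/
lemma comp_gramInv (T : E →L[ℂ] F) : T ∘L gramInv T = gramInv T.adjoint ∘L T := by
  have h1 := gramInv_mul T.adjoint
  have h2 := mul_gramInv T
  rw [adjoint_adjoint] at h1
  calc T ∘L gramInv T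
      = (gramInv T.adjoint * (1 + T ∘L T.adjoint)) ∘L (T ∘L gramInv T) := by
        rw [h1]; rfl
    _ = gramInv T.adjoint ∘L T ∘L ((1 + T.adjoint ∘L T) * gramInv T) := by
        ext x; simp
    _ = gramInv T.adjoint ∘L T := by rw [h2]; rfl

lemma contDiff_one_add_adjoint_comp :
    ContDiff ℝ ∞ fun T : HS E F => (1 : E →L[ℂ] E) + T.op.adjoint ∘L T.op := by
  have h1 : ContDiff ℝ ∞ fun p : (F →L[ℂ] E) × (E →L[ℂ] F) => p.1 ∘L p.2 :=
    (isBoundedBilinearMap_comp (𝕜 := ℂ)).contDiff.restrict_scalars ℝ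
  have h2 : ContDiff ℝ ∞ (HS.opL (E := E) (F := F)) := (HS.opL.restrictScalars ℝ).contDiff
  have h2' : ContDiff ℝ ∞ (HS.opL (E := F) (F := E)) := (HS.opL.restrictScalars ℝ).contDiff
  have h3 := h2'.comp (HS.adjL (E := E) (F := F)).contDiff
  exact contDiff_const.add (h1.comp (h3.prodMk h2))

lemma contDiff_gramInv_op : ContDiff ℝ ∞ fun T : HS E F => gramInv T.op := by
  rw [contDiff_iff_contDiffAt]
  intro T
  obtain ⟨u, hu⟩ := isUnit_one_add_adjoint_comp T.op
  have h := (contDiffAt_ringInverse (n := ∞) ℂ u).restrict_scalars ℝ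
  rw [hu] at h
  exact ContDiffAt.comp T h contDiff_one_add_adjoint_comp.contDiffAt

/-- The Hermitian form `Tr (R A† R' B)` with `R = (1 + X†X)⁻¹`, `R' = (1 + X X†)⁻¹`: the
Fubini–Study metric of the Grassmannian at the graph of `X`, in graph coordinates. It is written as
the Hilbert–Schmidt inner product of `A R` and `R' B`. -/
def fubiniStudy (X A B : HS E F) : ℂ :=
  ⟪HS.rcomp A (gramInv X.op), HS.lcomp (gramInv X.op.adjoint) B⟫_ℂ

lemma contDiff_fubiniStudy :
    ContDiff ℝ ∞ fun z : HS E F × HS E F × HS E F => fubiniStudy z.1 z.2.1 z.2.2 := by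
  have h0 : ContDiff ℝ ∞ fun T : HS E F => gramInv T.adj.op :=
    ContDiff.comp (g := fun T : HS F E => gramInv T.op) contDiff_gramInv_op
      (HS.adjL (E := E) (F := F)).contDiff
  have h1 : ContDiff ℝ ∞ fun z : HS E F × HS E F × HS E F => gramInv z.1.op :=
    ContDiff.comp (g := fun T : HS E F => gramInv T.op) contDiff_gramInv_op contDiff_fst
  have h2 : ContDiff ℝ ∞ fun z : HS E F × HS E F × HS E F => gramInv z.1.adj.op :=
    ContDiff.comp (g := fun T : HS E F => gramInv T.adj.op) h0 contDiff_fst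
  refine contDiff_iff_contDiffAt.2 fun z => ?_
  have h3 : ContDiffAt ℝ ∞ (fun z : HS E F × HS E F × HS E F => z.2.1) z :=
    (contDiff_fst.comp contDiff_snd).contDiffAt
  have h4 : ContDiffAt ℝ ∞ (fun z : HS E F × HS E F × HS E F => z.2.2) z :=
    (contDiff_snd.comp contDiff_snd).contDiffAt
  have h5 := h3.hs_rcomp h1.contDiffAt
  have h6 := h2.contDiffAt.hs_lcomp h4
  exact ContDiffAt.inner (𝕜 := ℂ) (E := HS E F) (n := ∞) h5 h6

lemma hasDerivAt_gramInv (X C : E →L[ℂ] F) :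
    HasDerivAt (fun t : ℝ => gramInv (X + t • C))
      (-(gramInv X * (X.adjoint ∘L C + C.adjoint ∘L X) * gramInv X)) 0 := by
  have h1 : HasDerivAt (fun t : ℝ => (1 : E →L[ℂ] E) + (X + t • C).adjoint ∘L (X + t • C))
      (X.adjoint ∘L C + C.adjoint ∘L X) 0 := by
    have hp : ∀ t : ℝ, (1 : E →L[ℂ] E) + (X + t • C).adjoint ∘L (X + t • C) =
        (1 + X.adjoint ∘L X) + t • (X.adjoint ∘L C + C.adjoint ∘L X) +
          t ^ 2 • (C.adjoint ∘L C) := by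
      intro t
      have ht : (X + t • C).adjoint = X.adjoint + t • C.adjoint := by
        rw [map_add]
        congr 1
        change adjoint ((t : ℂ) • C) = (t : ℂ) • C.adjoint
        rw [map_smulₛₗ, Complex.conj_ofReal]
      rw [ht]
      ext x
      simp
      module
    simp only [hp]
    have ha := ((hasDerivAt_id' (0 : ℝ)).smul_const (X.adjoint ∘L C + C.adjoint ∘L X)).const_add
      (1 + X.adjoint ∘L X)
    have hb := (hasDerivAt_pow 2 (0 : ℝ)).smul_const (C.adjoint ∘L C)
    exact (ha.add hb).congr_deriv (by simp)
  obtain ⟨u, hu⟩ := isUnit_one_add_adjoint_comp X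
  have h2 := (hasFDerivAt_ringInverse (𝕜 := ℂ) u).restrictScalars ℝ
  have h0 : (1 : E →L[ℂ] E) + (X + (0 : ℝ) • C).adjoint ∘L (X + (0 : ℝ) • C) = u := by
    rw [hu]; simp
  rw [← h0] at h2
  have h3 := h2.comp_hasDerivAt 0 h1
  have h4 : gramInv X = (u⁻¹ : (E →L[ℂ] E)ˣ) := by rw [gramInv, ← hu, Ring.inverse_unit]
  rw [h4]
  exact h3

/-- The third-order term `Tr (R C† R' X A† R' B)` in the derivative of the Fubini–Study metric. -/
def fubiniStudyCubic (X C A B : HS E F) : ℂ :=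
  ⟪HS.rcomp C (gramInv X.op), HS.lcomp (gramInv X.op.adjoint ∘L X.op ∘L A.op.adjoint ∘L
    gramInv X.op.adjoint) B⟫_ℂ

/-- Since `dR = -R (C†X + X†C) R` for `R = (1 + X†X)⁻¹`, the derivative of the Fubini–Study metric
has four terms. By `X R = R' X` they are values of one cubic form and of its conjugate. -/
lemma hasDerivAt_fubiniStudy (X C A B : HS E F) :
    HasDerivAt (fun t : ℝ => fubiniStudy (X + t • C) A B)
      (-(fubiniStudyCubic X C A B + starRingEnd ℂ (fubiniStudyCubic X C B A) +
        fubiniStudyCubic X A C B + starRingEnd ℂ (fubiniStudyCubic X B C A))) 0 := by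
  have hX : gramInv X.op.adjoint ∘L X.op = X.op ∘L gramInv X.op := (comp_gramInv _).symm
  have hX' : X.op.adjoint ∘L gramInv X.op.adjoint = gramInv X.op ∘L X.op.adjoint := by
    have := comp_gramInv X.op.adjoint
    rwa [adjoint_adjoint] at this
  set R := gramInv X.op with hR
  set R' := gramInv X.op.adjoint with hR'
  have hRa : R.adjoint = R := adjoint_gramInv _
  have hRa' : R'.adjoint = R' := adjoint_gramInv _
  have hop : ∀ t : ℝ, (X + t • C).op = X.op + t • C.op := fun t => by
    rw [map_add]; rfl
  have hop' : ∀ t : ℝ, (X + t • C).op.adjoint = X.op.adjoint + t • C.op.adjoint := fun t => by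
    rw [hop, map_add]
    congr 1
    change adjoint ((t : ℂ) • C.op) = (t : ℂ) • C.op.adjoint
    rw [map_smulₛₗ, Complex.conj_ofReal]
  have d1 := hasDerivAt_gramInv X.op C.op
  have d2 := hasDerivAt_gramInv X.op.adjoint C.op.adjoint
  simp only [← hop] at d1
  simp only [← hop'] at d2
  rw [adjoint_adjoint, adjoint_adjoint] at d2
  have d3 := (hasDerivAt_const (0 : ℝ) A).hs_rcomp d1
  have d4 := d2.hs_lcomp (hasDerivAt_const (0 : ℝ) B)
  have d5 := HasDerivAt.inner ℂ d3 d4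
  refine d5.congr_deriv ?_
  simp only [zero_smul, add_zero, ← hR, ← hR']
  have e1 : ⟪HS.rcomp A (R ∘L C.op.adjoint ∘L X.op ∘L R), HS.lcomp R' B⟫_ℂ =
      starRingEnd ℂ (fubiniStudyCubic X C B A) := by
    rw [fubiniStudyCubic, inner_conj_symm, HS.inner_lcomp_left, HS.inner_rcomp_left]
    congr 1
    refine HS.op_injective ?_
    simp only [HS.op_rcomp, HS.op_lcomp, adjoint_comp, adjoint_adjoint, ← hR, ← hR', hRa, hRa',
      comp_assoc]
    rw [← comp_assoc X.op.adjoint R', hX', comp_assoc]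
  have e2 : ⟪HS.rcomp A (R ∘L X.op.adjoint ∘L C.op ∘L R), HS.lcomp R' B⟫_ℂ =
      fubiniStudyCubic X C A B := by
    have h : HS.rcomp A (R ∘L X.op.adjoint ∘L C.op ∘L R) =
        HS.lcomp (A.op ∘L R ∘L X.op.adjoint) (HS.rcomp C R) := HS.ext fun x => rfl
    rw [fubiniStudyCubic, h, HS.inner_lcomp_left]
    congr 1
    refine HS.op_injective ?_
    simp only [HS.op_lcomp, adjoint_comp, adjoint_adjoint, ← hR', hRa, comp_assoc]
    rw [← comp_assoc X.op R, ← hX, comp_assoc]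
  have e3 : ⟪HS.rcomp A R, HS.lcomp (R' ∘L X.op ∘L C.op.adjoint ∘L R') B⟫_ℂ =
      fubiniStudyCubic X A C B := rfl
  have e4 : ⟪HS.rcomp A R, HS.lcomp (R' ∘L C.op ∘L X.op.adjoint ∘L R') B⟫_ℂ =
      starRingEnd ℂ (fubiniStudyCubic X B C A) := by
    rw [fubiniStudyCubic, inner_conj_symm, HS.inner_lcomp_left, HS.inner_rcomp_left]
    congr 1
    refine HS.op_injective ?_
    simp only [HS.op_rcomp, HS.op_lcomp, adjoint_comp, adjoint_adjoint, ← hR, ← hR', hRa, hRa',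
      comp_assoc]
  have f1 : HS.rcomp A (-(R * (X.op.adjoint ∘L C.op + C.op.adjoint ∘L X.op) * R)) =
      -(HS.rcomp A (R ∘L X.op.adjoint ∘L C.op ∘L R) +
        HS.rcomp A (R ∘L C.op.adjoint ∘L X.op ∘L R)) := HS.ext fun x => by simp
  have f2 : HS.lcomp (-(R' * (X.op ∘L C.op.adjoint + C.op ∘L X.op.adjoint) * R')) B =
      -(HS.lcomp (R' ∘L X.op ∘L C.op.adjoint ∘L R') B +
        HS.lcomp (R' ∘L C.op ∘L X.op.adjoint ∘L R') B) := HS.ext fun x => by simp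
  have f3 : HS.lcomp R' (0 : HS E F) = 0 := HS.ext fun x => by simp
  have f4 : HS.rcomp (0 : HS E F) R = 0 := HS.ext fun x => by simp
  rw [f1, f2, f3, f4]
  simp only [zero_add, add_zero, inner_neg_left, inner_neg_right, inner_add_left, inner_add_right,
    e1, e2, e3, e4]
  ring

omit [CompleteSpace E] [CompleteSpace F] in
/-- The terms in the derivative of the Fubini–Study metric cancel in pairs in the cyclic sum of the
imaginary parts, for whatever function `u` in place of the cubic term. -/
lemma fubiniStudyCubic_cyclic {V : Type*} (u : V → V → V → ℂ) (A B C : V) :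
    (-(u A B C + starRingEnd ℂ (u A C B) + u B A C + starRingEnd ℂ (u C A B))).im +
    (-(u B C A + starRingEnd ℂ (u B A C) + u C B A + starRingEnd ℂ (u A B C))).im +
    (-(u C A B + starRingEnd ℂ (u C B A) + u A C B + starRingEnd ℂ (u B C A))).im = 0 := by
  simp only [Complex.neg_im, Complex.add_im, Complex.conj_im]
  ring

end FubiniStudy

/-! ### The symplectic form -/

section SymplecticForm

open ContinuousLinearMap

variable {H : Type*} [NormedAddCommGroup H] [InnerProductSpace ℂ H] [CompleteSpace H]

/-- The symplectic form is the imaginary part of the Hilbert–Schmidt inner product. -/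
lemma grForm_eq (W : ClosedSubmodule ℂ H) (A B : GrTangent W) :
    grForm W A B = ((⟪A, B⟫_ℂ).im : ℂ) := by
  have h : opTrace W.toSubmodule (A.op.adjoint ∘L B.op - B.op.adjoint ∘L A.op) =
      ⟪A, B⟫_ℂ - ⟪B, A⟫_ℂ := by
    have h1 : Summable fun i => ⟪A.op (onb _ i), B.op (onb _ i)⟫_ℂ :=
      lp.summable_inner (𝕜 := ℂ) (HS.toLp A) (HS.toLp B)
    have h2 : Summable fun i => ⟪B.op (onb _ i), A.op (onb _ i)⟫_ℂ :=
      lp.summable_inner (𝕜 := ℂ) (HS.toLp B) (HS.toLp A)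
    rw [HS.inner_eq_tsum, HS.inner_eq_tsum, ← h1.tsum_sub h2]
    refine tsum_congr fun i => ?_
    simp [adjoint_inner_right]
  rw [grForm, h, ← inner_conj_symm B A]
  generalize ⟪A, B⟫_ℂ = z
  apply Complex.ext <;> simp
  ring

variable {p : ClosedSubmodule ℂ H}

/-- At a point `X` that goes to `0` the denominator of the change of coordinates does not contribute
to the derivative. -/
lemma fderiv_graphTransition {q : ClosedSubmodule ℂ H} {c : HS p.toSubmodule q.toSubmoduleᗮ}
    {X : GrTangent p} (hX : X ∈ graphOverlap p q)
    (hc : c + HS.lcomp (p.toSubmoduleᗮ.projBlock q.toSubmoduleᗮ) X = 0) (A : GrTangent p) :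
    fderiv ℝ (graphTransition c) X A =
      HS.rcomp (HS.lcomp (p.toSubmoduleᗮ.projBlock q.toSubmoduleᗮ) A)
        (graphBase p q X.op).inverse := by
  have hline : HasDerivAt (fun t : ℝ => X + t • A) A 0 := by
    simpa using! ((hasDerivAt_id' (0 : ℝ)).smul_const A).const_add X
  have h0 : X + (0 : ℝ) • A = X := by simp
  have d1 : HasDerivAt (fun t : ℝ => graphTransition c (X + t • A))
      (fderiv ℝ (graphTransition c) X A) 0 :=
    (((contDiffAt_graphTransition c hX).differentiableAt (by simp)).hasFDerivAt).hasLineDerivAt A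
  have d2' := ((contDiffAt_graphBase_inverse hX).differentiableAt (by simp)).hasFDerivAt
  have d2 := d2'.comp_hasDerivAt_of_eq 0 hline h0.symm
  have d3 : HasDerivAt (fun t : ℝ => c + HS.lcomp (p.toSubmoduleᗮ.projBlock q.toSubmoduleᗮ)
      (X + t • A)) (HS.lcomp (p.toSubmoduleᗮ.projBlock q.toSubmoduleᗮ) A) 0 := by
    have := ((hasDerivAt_const (0 : ℝ) (p.toSubmoduleᗮ.projBlock q.toSubmoduleᗮ)).hs_lcomp
      hline).const_add c
    refine this.congr_deriv ?_
    exact HS.ext fun x => by simp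
  have d4 := d3.hs_rcomp d2
  refine (d1.unique d4).trans ?_
  rw [h0, hc, Function.comp_apply, h0]
  exact HS.ext fun x => by simp

/-- The derivative at `X` of the coordinate change from the parametrization around `p` to the one
around the point with coordinate `X`. -/
lemma fderiv_transition_grChart (X A : GrTangent p) :
    fderiv ℝ (transition (E := GrTangent (H := H)) grChart p (grChart p X)) X A =
      HS.rcomp (HS.lcomp (p.toSubmoduleᗮ.projBlock (grChart p X).toSubmoduleᗮ) A)
        (graphBase p (grChart p X) X.op).inverse := by
  have hcX : p.toSubmodule.projBlock (grChart p X).toSubmoduleᗮ +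
      p.toSubmoduleᗮ.projBlock (grChart p X).toSubmoduleᗮ ∘L X.op = 0 := by
    change graphFibre p (grChart p X) X.op = 0
    ext x : 1
    rw [graphFibre_apply, zero_apply, Submodule.orthogonalProjectionOnto_eq_zero_iff]
    exact Submodule.le_orthogonal_orthogonal _ (add_mem_graphSubspace p X.op x)
  let c : HS p.toSubmodule (grChart p X).toSubmoduleᗮ :=
    -HS.lcomp (p.toSubmoduleᗮ.projBlock (grChart p X).toSubmoduleᗮ) X
  have hc : c.op = p.toSubmodule.projBlock (grChart p X).toSubmoduleᗮ := by
    rw [eq_neg_of_add_eq_zero_left hcX]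
    simp [c]
  have hX : X ∈ graphOverlap p (grChart p X) := by
    rw [← preimage_range_grChart hc]
    exact ⟨0, grChart_zero _⟩
  have heq : transition (E := GrTangent (H := H)) grChart p (grChart p X) =ᶠ[nhds X]
      graphTransition c := by
    filter_upwards [isOpen_graphOverlap.mem_nhds hX] with T hT
    exact transition_eq_graphTransition hc hT
  rw [heq.fderiv_eq]
  exact fderiv_graphTransition hX (neg_add_cancel _) A

/-- The map `x ↦ x + T x` from `p` to the graph of `T` pulls the inner product of `H` back to
`⟪x, (1 + T†T) y⟫`. -/
lemma adjoint_graphBase_comp_self (T : p.toSubmodule →L[ℂ] p.toSubmoduleᗮ) :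
    (graphBase p (graphSubspace p T) T).adjoint ∘L graphBase p (graphSubspace p T) T =
      1 + T.adjoint ∘L T := by
  have hb : ∀ x, (graphBase p (graphSubspace p T) T x : H) = x + T x := fun x => by
    rw [graphBase_apply]
    exact congrArg Subtype.val (Submodule.orthogonalProjectionOnto_mem_subspace_eq_self
      (⟨_, add_mem_graphSubspace p T x⟩ : (graphSubspace p T).toSubmodule))
  ext y : 1
  refine ext_inner_left ℂ fun x => ?_
  rw [ContinuousLinearMap.comp_apply, adjoint_inner_right, Submodule.coe_inner, hb, hb]
  have h1 : ⟪(x : H), (T y : H)⟫_ℂ = 0 := Submodule.inner_right_of_mem_orthogonal x.2 (T y).2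
  have h2 : ⟪(T x : H), (y : H)⟫_ℂ = 0 := Submodule.inner_left_of_mem_orthogonal y.2 (T x).2
  simp [inner_add_left, inner_add_right, h1, h2, adjoint_inner_right]

/-- The orthogonal complement of the graph of `T` is `{w - T† w | w ∈ pᗮ}`, and the projection to it
takes `w + T T† w = (w - T† w) + (T† w + T T† w)` to `w - T† w`. -/
lemma adjoint_projBlock_comp_self (T : p.toSubmodule →L[ℂ] p.toSubmoduleᗮ) :
    (p.toSubmoduleᗮ.projBlock (graphSubspace p T).toSubmoduleᗮ).adjoint ∘L
      p.toSubmoduleᗮ.projBlock (graphSubspace p T).toSubmoduleᗮ = gramInv T.adjoint := by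
  symm
  refine gramInv_eq_of_mul_eq_one' ?_
  rw [Submodule.adjoint_projBlock, adjoint_adjoint]
  ext w : 1
  have hmem : (w : H) - T.adjoint w ∈ (graphSubspace p T).toSubmoduleᗮ := by
    rw [Submodule.mem_orthogonal]
    intro v hv
    obtain ⟨x, rfl⟩ := exists_of_mem_graphSubspace hv
    have h1 : ⟪(x : H), (w : H)⟫_ℂ = 0 := Submodule.inner_right_of_mem_orthogonal x.2 w.2
    have h2 : ⟪(T x : H), (T.adjoint w : H)⟫_ℂ = 0 :=
      Submodule.inner_left_of_mem_orthogonal (T.adjoint w).2 (T x).2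
    have h3 : ⟪(T x : H), (w : H)⟫_ℂ = ⟪(x : H), (T.adjoint w : H)⟫_ℂ := by
      rw [← Submodule.coe_inner, ← Submodule.coe_inner, adjoint_inner_right]
    rw [inner_add_left, inner_sub_right, inner_sub_right, h1, h2, h3]
    ring
  have hd : (graphSubspace p T).toSubmoduleᗮ.orthogonalProjectionOnto
      ((w : H) + T (T.adjoint w)) = ⟨_, hmem⟩ := by
    have h1 : (w : H) + T (T.adjoint w) =
        ((w : H) - T.adjoint w) + ((T.adjoint w : H) + T (T.adjoint w)) := by abel
    have h2 : (graphSubspace p T).toSubmoduleᗮ.orthogonalProjectionOnto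
        ((T.adjoint w : H) + T (T.adjoint w)) = 0 :=
      Submodule.orthogonalProjectionOnto_eq_zero_iff.2
        (Submodule.le_orthogonal_orthogonal _ (add_mem_graphSubspace p T _))
    rw [h1, map_add, h2, add_zero]
    exact Submodule.orthogonalProjectionOnto_mem_subspace_eq_self
      (⟨_, hmem⟩ : ↥(graphSubspace p T).toSubmoduleᗮ)
  change p.toSubmoduleᗮ.orthogonalProjectionOnto
    ((graphSubspace p T).toSubmoduleᗮ.orthogonalProjectionOnto ((w : H) + T (T.adjoint w)) : H) = w
  rw [hd]
  have h2 : p.toSubmoduleᗮ.orthogonalProjectionOnto (T.adjoint w : H) = 0 :=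
      Submodule.orthogonalProjectionOnto_eq_zero_iff.2
        (Submodule.le_orthogonal_orthogonal _ (T.adjoint w).2)
  change p.toSubmoduleᗮ.orthogonalProjectionOnto ((w : H) - T.adjoint w) = w
  rw [map_sub, h2, sub_zero]
  exact Submodule.orthogonalProjectionOnto_mem_subspace_eq_self w

lemma inverse_comp_adjoint_graphBase (T : p.toSubmodule →L[ℂ] p.toSubmoduleᗮ) :
    (graphBase p (graphSubspace p T) T).inverse ∘L
      (graphBase p (graphSubspace p T) T).inverse.adjoint = gramInv T := by
  symm
  refine gramInv_eq_of_mul_eq_one ?_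
  rw [← adjoint_graphBase_comp_self]
  have hinv : (graphBase p (graphSubspace p T) T).IsInvertible :=
    (graphSubspace_eq_iff.1 (graphSubspace_zero (graphSubspace p T)).symm).1
  set e := graphBase p (graphSubspace p T) T
  have h1 : e ∘L e.inverse = ContinuousLinearMap.id ℂ _ := hinv.self_comp_inverse
  have h2 : e.inverse ∘L e = ContinuousLinearMap.id ℂ _ := hinv.inverse_comp_self
  calc (e.adjoint ∘L e) * (e.inverse ∘L e.inverse.adjoint)
      = e.adjoint ∘L (e ∘L e.inverse) ∘L e.inverse.adjoint := rfl
    _ = (e.inverse ∘L e).adjoint := by rw [h1, id_comp, adjoint_comp]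
    _ = 1 := by rw [h2]; exact adjoint_id

/-- In graph coordinates the symplectic form is the imaginary part of the Fubini–Study metric. -/
lemma localForm_grForm (X A B : GrTangent p) :
    localForm (E := GrTangent (H := H)) grChart grForm p X A B = ((fubiniStudy X A B).im : ℂ) := by
  rw [localForm, grForm_eq, fderiv_transition_grChart, fderiv_transition_grChart]
  have h1 : (p.toSubmoduleᗮ.projBlock (grChart p X).toSubmoduleᗮ).adjoint ∘L
      p.toSubmoduleᗮ.projBlock (grChart p X).toSubmoduleᗮ = gramInv X.op.adjoint :=
    adjoint_projBlock_comp_self X.op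
  have h2 : (graphBase p (grChart p X) X.op).inverse ∘L
      (graphBase p (grChart p X) X.op).inverse.adjoint = gramInv X.op :=
    inverse_comp_adjoint_graphBase X.op
  rw [HS.inner_conjugate, h1, h2, fubiniStudy]

lemma contDiff_localForm_grForm :
    ContDiff ℝ ∞ fun z : GrTangent p × GrTangent p × GrTangent p =>
      localForm (E := GrTangent (H := H)) grChart grForm p z.1 z.2.1 z.2.2 := by
  simp only [localForm_grForm]
  exact Complex.ofRealCLM.contDiff.comp (Complex.imCLM.contDiff.comp contDiff_fubiniStudy)

lemma fderiv_localForm_grForm (X C A B : GrTangent p) :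
    fderiv ℝ (fun Y => localForm (E := GrTangent (H := H)) grChart grForm p Y A B) X C =
      ((-(fubiniStudyCubic X C A B + starRingEnd ℂ (fubiniStudyCubic X C B A) +
        fubiniStudyCubic X A C B + starRingEnd ℂ (fubiniStudyCubic X B C A))).im : ℂ) := by
  have hf : ContDiff ℝ ∞ fun Y : GrTangent p => (Y, A, B) := contDiff_id.prodMk contDiff_const
  have hdiff := contDiff_localForm_grForm.comp hf
  have d1 : HasDerivAt (fun t : ℝ => localForm (E := GrTangent (H := H)) grChart grForm p
      (X + t • C) A B) _ 0 :=
    ((hdiff.differentiable (by simp)) X).hasFDerivAt.hasLineDerivAt C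
  simp only [localForm_grForm] at d1 ⊢
  have d2 := (Complex.imCLM.hasFDerivAt.comp_hasDerivAt (0 : ℝ)
    (hasDerivAt_fubiniStudy X C A B)).ofReal_comp
  exact d1.unique d2

/-- The form `Ω` is symplectic; this does not depend on the set of subspaces on which it is
considered. -/
theorem isSymplecticForm_grForm (N : Set (ClosedSubmodule ℂ H)) :
    IsSymplecticForm (E := GrTangent (H := H)) grChart grForm N where
  real p _ A B := by rw [grForm_eq, Complex.ofReal_im]
  add_left p _ A A' B := by
    simp only [grForm_eq, inner_add_left, Complex.add_im, Complex.ofReal_add]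
  smul_left p _ c A B := by
    have h : c • A = (c : ℂ) • A := rfl
    rw [grForm_eq, grForm_eq, h, inner_smul_left, Complex.conj_ofReal, Complex.im_ofReal_mul,
      Complex.ofReal_mul]
  antisymm p _ A B := by
    rw [grForm_eq, grForm_eq, ← inner_conj_symm, Complex.conj_im, Complex.ofReal_neg]
  nondegenerate p _ A h := by
    have h1 := h (Complex.I • A)
    rw [grForm_eq, inner_smul_right, inner_self_eq_norm_sq_to_K] at h1
    have h2 : ‖A‖ ^ 2 = 0 := by
      have : ((Complex.I * ((‖A‖ : ℂ) ^ 2)).im : ℂ) = 0 := h1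
      rw [← Complex.ofReal_pow, Complex.I_mul_im, Complex.ofReal_re] at this
      exact_mod_cast this
    exact norm_eq_zero.1 (pow_eq_zero_iff two_ne_zero |>.1 h2)
  smooth p _ := contDiff_localForm_grForm
  closed p _ X A B C := by
    rw [fderiv_localForm_grForm, fderiv_localForm_grForm, fderiv_localForm_grForm]
    exact_mod_cast fubiniStudyCubic_cyclic (fubiniStudyCubic X) A B C

end SymplecticForm

/-! ### Lagrangian subspaces in graph coordinates -/

section Lagrangian

open ContinuousLinearMap

variable {H : Type*} [NormedAddCommGroup H] [InnerProductSpace ℂ H]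

lemma CompatibleStructure.inner_J_left (𝒥 : CompatibleStructure H) (x y : H) :
    ⟪𝒥.J x, y⟫_ℂ = -⟪x, 𝒥.J y⟫_ℂ := by
  rw [← 𝒥.isometry (𝒥.J x) y, 𝒥.sq, inner_neg_left]

variable [CompleteSpace H]

variable {𝒥 : CompatibleStructure H}

/-- A closed subspace is Lagrangian if it is the orthogonal complement of its image under `J`. -/
def CompatibleStructure.IsLagrangian (𝒥 : CompatibleStructure H) (W : ClosedSubmodule ℂ H) : Prop :=
  ∀ ψ, ψ ∈ W ↔ ∀ φ ∈ W, ⟪𝒥.J φ, ψ⟫_ℂ = 0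

lemma Polarization.mem_selfAdjointSubspaces_iff (P : Polarization 𝒥) (W : ClosedSubmodule ℂ H) :
    W ∈ P.selfAdjointSubspaces ↔ 𝒥.IsLagrangian W := by
  change (W : Set H) = P.adjointSet W ↔ _
  rw [Set.ext_iff]
  exact forall_congr' fun ψ => by rw [P.mem_adjointSet_iff]; rfl

namespace CompatibleStructure.IsLagrangian

variable {p : ClosedSubmodule ℂ H}

omit [CompleteSpace H] in
lemma J_mem_orthogonal (hp : 𝒥.IsLagrangian p) {x : H} (hx : x ∈ p) : 𝒥.J x ∈ p.toSubmoduleᗮ := by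
  rw [Submodule.mem_orthogonal]
  intro y hy
  rw [← inner_conj_symm, (hp y).1 hy x hx, map_zero]

omit [CompleteSpace H] in
lemma J_mem (hp : 𝒥.IsLagrangian p) {x : H} (hx : x ∈ p.toSubmoduleᗮ) : 𝒥.J x ∈ p := by
  refine (hp _).2 fun y hy => ?_
  rw [𝒥.isometry]
  exact Submodule.inner_right_of_mem_orthogonal (show y ∈ p.toSubmodule from hy) hx

/-- The restriction of `J` to a Lagrangian subspace `p`, an isomorphism `p → pᗮ`. -/
def J₀ (hp : 𝒥.IsLagrangian p) : p.toSubmodule →L[ℂ] p.toSubmoduleᗮ :=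
  (𝒥.J ∘L p.toSubmodule.subtypeL).codRestrict _ fun x => hp.J_mem_orthogonal x.2

omit [CompleteSpace H] in
lemma coe_J₀ (hp : 𝒥.IsLagrangian p) (x : p.toSubmodule) : (hp.J₀ x : H) = 𝒥.J x := rfl

lemma coe_adjoint_J₀ (hp : 𝒥.IsLagrangian p) (w : p.toSubmoduleᗮ) :
    (hp.J₀.adjoint w : H) = -𝒥.J w := by
  have h : hp.J₀.adjoint w = -⟨𝒥.J w, hp.J_mem w.2⟩ := by
    refine ext_inner_left ℂ fun x => ?_
    rw [adjoint_inner_right, inner_neg_right, Submodule.coe_inner, Submodule.coe_inner, coe_J₀,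
      𝒥.inner_J_left]
  rw [h]; rfl

@[simp] lemma adjoint_J₀_J₀ (hp : 𝒥.IsLagrangian p) (x : p.toSubmodule) :
    hp.J₀.adjoint (hp.J₀ x) = x :=
  Subtype.ext (by rw [coe_adjoint_J₀, coe_J₀, 𝒥.sq, neg_neg])

@[simp] lemma J₀_adjoint_J₀ (hp : 𝒥.IsLagrangian p) (w : p.toSubmoduleᗮ) :
    hp.J₀ (hp.J₀.adjoint w) = w :=
  Subtype.ext (by rw [coe_J₀, coe_adjoint_J₀, map_neg, 𝒥.sq, neg_neg])

lemma adjoint_J₀_comp (hp : 𝒥.IsLagrangian p) : hp.J₀.adjoint ∘L hp.J₀ = 1 :=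
  ContinuousLinearMap.ext hp.adjoint_J₀_J₀

lemma J₀_comp_adjoint (hp : 𝒥.IsLagrangian p) : hp.J₀ ∘L hp.J₀.adjoint = 1 :=
  ContinuousLinearMap.ext hp.J₀_adjoint_J₀

/-- The conjugation `T ↦ J T† J` of the tangent space at a Lagrangian subspace `p`. Under the
identification of `p` with `pᗮ` by `J`, it is the passage to the adjoint. -/
def conj (hp : 𝒥.IsLagrangian p) (T : GrTangent p) : GrTangent p :=
  HS.rcomp (HS.lcomp hp.J₀ T.adj) hp.J₀

lemma conj_conj (hp : 𝒥.IsLagrangian p) (T : GrTangent p) : hp.conj (hp.conj T) = T :=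
  HS.ext fun x => by simp [conj, adjoint_comp]

lemma inner_conj_conj (hp : 𝒥.IsLagrangian p) (A B : GrTangent p) :
    ⟪hp.conj A, hp.conj B⟫_ℂ = ⟪B, A⟫_ℂ := by
  rw [conj, conj, HS.inner_conjugate, hp.adjoint_J₀_comp, hp.J₀_comp_adjoint, ← HS.inner_adj_adj]
  have h1 : HS.lcomp 1 B.adj = B.adj := HS.ext fun x => rfl
  have h2 : HS.rcomp A.adj 1 = A.adj := HS.ext fun x => rfl
  rw [h1, h2, HS.adj_adj, HS.adj_adj]

lemma conj_smul (hp : 𝒥.IsLagrangian p) (c : ℂ) (A : GrTangent p) :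
    hp.conj (c • A) = starRingEnd ℂ c • hp.conj A := by
  refine HS.ext fun x => ?_
  rw [conj, HS.adj_smul]
  simp [conj]

/-- The conjugation as a bounded real-linear map. -/
def conjL (hp : 𝒥.IsLagrangian p) : GrTangent p →L[ℝ] GrTangent p :=
  LinearMap.mkContinuous
    { toFun := hp.conj
      map_add' := fun A B => HS.ext fun x => by simp [conj, HS.adj_add]
      map_smul' := fun c A => by
        have := hp.conj_smul (c : ℂ) A
        rwa [Complex.conj_ofReal] at this } 1 fun A => by
      have h : ‖hp.conj A‖ ^ 2 = ‖A‖ ^ 2 := by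
        have := hp.inner_conj_conj A A
        rw [inner_self_eq_norm_sq_to_K, inner_self_eq_norm_sq_to_K] at this
        exact_mod_cast this
      rw [one_mul]
      exact ((sq_eq_sq₀ (norm_nonneg _) (norm_nonneg _)).1 h).le

@[simp] lemma conjL_apply (hp : 𝒥.IsLagrangian p) (A : GrTangent p) : hp.conjL A = hp.conj A := rfl

/-- The real subspace of tangent vectors that are fixed by the conjugation. -/
def fixedSubmodule (hp : 𝒥.IsLagrangian p) : Submodule ℝ (GrTangent p) :=
  LinearMap.ker ((hp.conjL - ContinuousLinearMap.id ℝ _ : GrTangent p →L[ℝ] GrTangent p) :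
    GrTangent p →ₗ[ℝ] GrTangent p)

lemma mem_fixedSubmodule_iff (hp : 𝒥.IsLagrangian p) (A : GrTangent p) :
    A ∈ hp.fixedSubmodule ↔ hp.conj A = A := by
  rw [fixedSubmodule, LinearMap.mem_ker]
  exact sub_eq_zero

/-- The projection onto the fixed vectors is the average `A ↦ (A + conj A) / 2`. -/
lemma closedComplemented_fixedSubmodule (hp : 𝒥.IsLagrangian p) :
    hp.fixedSubmodule.ClosedComplemented := by
  have h2 : ∀ A, ((2⁻¹ : ℝ) • (hp.conjL + ContinuousLinearMap.id ℝ (GrTangent p))) A ∈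
      hp.fixedSubmodule := by
    intro A
    refine hp.fixedSubmodule.smul_mem _ ((hp.mem_fixedSubmodule_iff _).2 ?_)
    have := map_add hp.conjL (hp.conj A) A
    simp only [conjL_apply, conj_conj] at this
    exact this.trans (add_comm _ _)
  refine ⟨((2⁻¹ : ℝ) • (hp.conjL + ContinuousLinearMap.id ℝ _)).codRestrict _ h2, fun A => ?_⟩
  refine Subtype.ext ?_
  change (2⁻¹ : ℝ) • (hp.conj A + (A : GrTangent p)) = A
  rw [(hp.mem_fixedSubmodule_iff _).1 A.2, ← two_smul ℝ, smul_smul]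
  norm_num

/-- In graph coordinates around a Lagrangian subspace `p`, the Lagrangian subspaces form a real
linear subspace. That the graph of `T` is isotropic means `T† J = J† T`, which is `J T† J = T`; and
every isotropic graph over `p` is maximal isotropic. -/
lemma isLagrangian_grChart_iff (hp : 𝒥.IsLagrangian p) (T : GrTangent p) :
    𝒥.IsLagrangian (grChart p T) ↔ T ∈ hp.fixedSubmodule := by
  rw [mem_fixedSubmodule_iff]
  have hform : ∀ (y a : p.toSubmodule) (b : p.toSubmoduleᗮ),
      ⟪𝒥.J ((y : H) + T.op y), (a : H) + b⟫_ℂ = ⟪hp.J₀ y, b⟫_ℂ - ⟪T.op y, hp.J₀ a⟫_ℂ := by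
    intro y a b
    have h1 : ⟪𝒥.J (y : H), (a : H)⟫_ℂ = 0 :=
      Submodule.inner_left_of_mem_orthogonal a.2 (hp.J_mem_orthogonal y.2)
    have h2 : ⟪𝒥.J (T.op y : H), (b : H)⟫_ℂ = 0 :=
      Submodule.inner_right_of_mem_orthogonal
        (show 𝒥.J (T.op y : H) ∈ p.toSubmodule from hp.J_mem (T.op y).2) b.2
    rw [map_add, inner_add_left, inner_add_right, inner_add_right, h1, h2,
      𝒥.inner_J_left (T.op y : H) a, Submodule.coe_inner, Submodule.coe_inner, coe_J₀, coe_J₀]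
    ring
  -- `conj T = T` in the form `T† J = J† T`
  have hconj : hp.conj T = T ↔ ∀ y, T.op.adjoint (hp.J₀ y) = hp.J₀.adjoint (T.op y) := by
    constructor
    · intro h y
      conv_rhs => rw [← h]
      simp [conj]
    · intro h
      refine HS.ext fun y => ?_
      simp [conj, h]
  rw [hconj]
  constructor
  · intro hL y
    refine ext_inner_right ℂ fun z => ?_
    have h := (hL _).1 (add_mem_graphSubspace p T.op z) _ (add_mem_graphSubspace p T.op y)
    rw [hform, sub_eq_zero] at h
    rwa [adjoint_inner_left, adjoint_inner_left]
  · intro h ψ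
    constructor
    · intro hψ φ hφ
      obtain ⟨y, rfl⟩ := exists_of_mem_graphSubspace hφ
      obtain ⟨z, rfl⟩ := exists_of_mem_graphSubspace hψ
      rw [hform, sub_eq_zero, ← adjoint_inner_left, ← adjoint_inner_left, h]
    · intro hψ
      refine (mem_graphSubspace_iff _ _ _).2 ?_
      set a := p.toSubmodule.orthogonalProjectionOnto ψ with ha
      set b := p.toSubmoduleᗮ.orthogonalProjectionOnto ψ with hb
      have hab : ψ = (a : H) + b :=
        (p.toSubmodule.starProjection_add_starProjection_orthogonal ψ).symm
      have h3 : hp.J₀.adjoint b = hp.J₀.adjoint (T.op a) := by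
        refine ext_inner_left ℂ fun y => ?_
        have h4 := hψ _ (add_mem_graphSubspace p T.op y)
        rw [hab, hform, sub_eq_zero] at h4
        rw [adjoint_inner_right, h4, ← h, adjoint_inner_right]
      rw [← hp.J₀_adjoint_J₀ b, h3, hp.J₀_adjoint_J₀]

/-- The fixed vectors of the antiunitary conjugation form a Lagrangian subspace for the imaginary
part of the inner product: inner products of fixed vectors are real. -/
lemma mem_fixedSubmodule_iff_forall_grForm (hp : 𝒥.IsLagrangian p) (A : GrTangent p) :
    A ∈ hp.fixedSubmodule ↔ ∀ B ∈ hp.fixedSubmodule, grForm p A B = 0 := by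
  simp only [grForm_eq, Complex.ofReal_eq_zero]
  constructor
  · intro hA B hB
    have h := hp.inner_conj_conj A B
    rw [(hp.mem_fixedSubmodule_iff _).1 hA, (hp.mem_fixedSubmodule_iff _).1 hB,
      ← inner_conj_symm B A] at h
    have := congrArg Complex.im h
    rw [Complex.conj_im] at this
    linarith
  · intro h
    -- The fixed vector `i (A - conj A)` has pairing `‖A - conj A‖² / 2` with `A`.
    have hd : hp.conj (A - hp.conj A) = -(A - hp.conj A) := by
      have := map_sub hp.conjL A (hp.conj A)
      simp only [conjL_apply, conj_conj] at this
      rw [this, neg_sub]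
    have hD : Complex.I • (A - hp.conj A) ∈ hp.fixedSubmodule := by
      rw [mem_fixedSubmodule_iff, conj_smul, Complex.conj_I]
      rw [hd, neg_smul, smul_neg, neg_neg]
    have h1 := h _ hD
    rw [inner_smul_right, Complex.I_mul_im] at h1
    have h2 := congrArg Complex.re (hp.inner_conj_conj A (A - hp.conj A))
    rw [hd, inner_neg_right, ← inner_conj_symm (A - hp.conj A) A, Complex.neg_re, Complex.conj_re,
      h1] at h2
    have h3 : ‖A - hp.conj A‖ ^ 2 = 0 := by
      have h4 := norm_sq_eq_re_inner (𝕜 := ℂ) (A - hp.conj A)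
      rw [inner_sub_left, RCLike.re_to_complex, Complex.sub_re, h1] at h4
      linarith
    rw [mem_fixedSubmodule_iff]
    exact (sub_eq_zero.1 (norm_eq_zero.1 (pow_eq_zero_iff two_ne_zero |>.1 h3))).symm

end CompatibleStructure.IsLagrangian

variable (P : Polarization 𝒥)

namespace Polarization

lemma grChart_mem_ellipticSelfAdjoint_iff {p : ClosedSubmodule ℂ H}
    (hp : p ∈ P.ellipticSelfAdjoint) (hL : 𝒥.IsLagrangian p) (T : GrTangent p) :
    grChart p T ∈ P.ellipticSelfAdjoint ↔ T ∈ hL.fixedSubmodule := by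
  rw [← hL.isLagrangian_grChart_iff, ← P.mem_selfAdjointSubspaces_iff]
  exact and_iff_left (P.grChart_mem hp.2 T)

/-- A curve of fixed vectors has fixed velocity, and a fixed vector is the velocity of a line. -/
lemma tangentSet_ellipticSelfAdjoint {p : ClosedSubmodule ℂ H} (hp : p ∈ P.ellipticSelfAdjoint)
    (hL : 𝒥.IsLagrangian p) :
    tangentSet (E := GrTangent (H := H)) grChart P.ellipticSelfAdjoint p = hL.fixedSubmodule := by
  ext v
  constructor
  · rintro ⟨c, -, -, hc, hv⟩
    let L : GrTangent p →L[ℝ] GrTangent p := hL.conjL - ContinuousLinearMap.id ℝ _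
    have h1 : HasDerivAt (fun t => L (c t)) (L v) 0 := L.hasFDerivAt.comp_hasDerivAt 0 hv
    have h2 : (fun t => L (c t)) =ᶠ[nhds 0] fun _ => 0 :=
      hc.mono fun t ht => (P.grChart_mem_ellipticSelfAdjoint_iff hp hL _).1 ht
    exact h1.unique ((hasDerivAt_const (0 : ℝ) (0 : GrTangent p)).congr_of_eventuallyEq h2)
  · intro hv
    refine ⟨fun t => t • v, zero_smul _ _, by fun_prop, .of_forall fun t => ?_, ?_⟩
    · exact (P.grChart_mem_ellipticSelfAdjoint_iff hp hL _).2 (hL.fixedSubmodule.smul_mem t hv)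
    · simpa using! (hasDerivAt_id' (0 : ℝ)).smul_const v

/-- The theorem for an arbitrary complex Hilbert space with a compatible complex structure and a
polarization. -/
theorem isLagrangianSubmanifold_ellipticSelfAdjoint :
    IsLagrangianSubmanifold (E := GrTangent (H := H)) grChart grForm
      P.restrictedGrassmannian P.ellipticSelfAdjoint where
  manifold := P.isSmoothManifold_restrictedGrassmannian
  symplectic := isSymplecticForm_grForm _
  subset := Set.inter_subset_right
  submanifold p hp := by
    have hL := (P.mem_selfAdjointSubspaces_iff p).1 hp.1
    exact ⟨OpenPartialHomeomorph.refl _, hL.fixedSubmodule, Set.mem_univ _, contDiffOn_id,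
      contDiffOn_id, hL.closedComplemented_fixedSubmodule,
      fun T _ => P.grChart_mem_ellipticSelfAdjoint_iff hp hL T⟩
  lagrangian p hp := by
    have hL := (P.mem_selfAdjointSubspaces_iff p).1 hp.1
    rw [P.tangentSet_ellipticSelfAdjoint hp hL]
    ext A
    exact hL.mem_fixedSubmodule_iff_forall_grForm A

end Polarization

end Lagrangian

/-! ### Boundary conditions of Dirac operators -/

theorem mainTheorem6 {n : ℕ} [NeZero n] {M : Type*} [EMetricSpace M] [CompactSpace M]
    [MeasurableSpace M] [BorelSpace M] [ChartedSpace (EuclideanHalfSpace n) M]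
    [IsManifold (𝓡∂ n) ∞ M] [Bundle.RiemannianBundle fun x : M => TangentSpace (𝓡∂ n) x]
    [IsContMDiffRiemannianBundle (𝓡∂ n) ∞ (EuclideanSpace ℝ (Fin n))
      fun x : M => TangentSpace (𝓡∂ n) x]
    [IsRiemannianManifold (𝓡∂ n) M]
    {F : Type*} [NormedAddCommGroup F] [NormedSpace ℂ F] [FiniteDimensional ℂ F]
    {S : M → Type*} [TopologicalSpace (Bundle.TotalSpace F S)]
    [∀ x, NormedAddCommGroup (S x)] [∀ x, InnerProductSpace ℂ (S x)] [FiberBundle F S]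
    [VectorBundle ℂ F S] [VectorBundle ℝ F S] [ContMDiffVectorBundle ∞ F S (𝓡∂ n)]
    (𝒟 : DiracBundle n F S) (ν : InwardNormal n M)
    (P : Polarization (𝒟.boundaryStructure ν)) :
    IsLagrangianSubmanifold (E := GrTangent (H := 𝒟.BoundarySpace)) grChart grForm
      P.restrictedGrassmannian P.ellipticSelfAdjoint :=
  P.isLagrangianSubmanifold_ellipticSelfAdjoint
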